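/- Let $d,n\ge 1$ and let $V=(v_{ij})\in\mathbb R^{d\times n}$ be a matrix with real entries. *Covector decomposition.* Let $\mathbb{TP}^{d-1}=\big((\mathbb R\cup\{-\infty\})^d\setminus\{-\infty\mathbf 1\}\big)/\mathbb R\mathbf 1$ be the max-tropical projective space with the quotient topology. The covector of $p=[x]\in\mathbb{TP}^{d-1}$ is $(G_1(p),\dots,G_d(p))$ with $G_i(p)=\{j\in[n] : x_i-v_{ij}=\min_k(x_k-v_{kj})\}$, and the stratum of $p$ is the set of all points with $-\infty$ in exactly the same coordinates as $p$. The covector decomposition of $\mathbb{TP}^{d-1}$ induced by $V$ has as its (nonempty, closed) cells the closures in $\mathbb{TP}^{d-1}$ of the sets $\{q \text{ in the stratum of } p : G_i(q)\supseteq G_i(p)\text{ for all } i\}$, $p\in\mathbb{TP}^{d-1}$. *Dome and facet at infinity.* Let $L_V(x)=\sum_{j=1}^n\min_i(x_i-v_{ij})$ and let $D(V)$ be the image of $\{(x,s)\in\mathbb R^d\times\mathbb R : s\le L_V(x)\}$ in the $d$-dimensional space $(\mathbb R^d\times\mathbb R)/\mathbb R(\mathbf 1,n)$. A projective transformation from this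 space to $\mathbb R^d$ is called admissible if it is defined on all of $D(V)$ and maps it to a bounded set. For an admissible transformation, let $Q$ be the closure of the image of $D(V)$, and let $E_\infty$ be the image of the recession cone of $D(V)$, each nonzero vector of the cone being read as a point at infinity. *Claim.* An admissible projective transformation exists. For each admissible projective transformation, $Q$ is a polytope and $E_\infty$ is a facet of $Q$ which is a $(d-1)$-dimensional simplex. Moreover, points beyond $E_\infty$ (violating the inequality that defines the facet $E_\infty$, and strictly satisfying those of all other facets of $Q$) exist, and for every such point $y$ the covector decomposition of $\mathbb{TP}^{d-1}$ induced by $V$ is combinatorially equivalent to the Schlegel diagram of $Q$ based at $E_\infty$ with centre $y$: the set of cells of the former, ordered by inclusion, is isomorphic as a partially ordered set to the set of images, under the central projection from $y$ to $\operatorname{aff}(E_\infty)$, of the nonempty proper faces of $Q$ other than $E_\infty$, ordered by inclusion. -/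

import Mathlib

/-! ### Tropical projective space and the covector decomposition -/

/-- Homogeneous coordinates: vectors with entries in `ℝ ∪ {-∞}`, not all equal to `-∞`. -/
def TropCoord (d : ℕ) : Type :=
  {x : Fin d → EReal // (∀ i, x i ≠ ⊤) ∧ ∃ i, x i ≠ ⊥}

/-- The topology induced by the product topology. -/
instance (d : ℕ) : TopologicalSpace (TropCoord d) :=
  inferInstanceAs (TopologicalSpace
    {x : Fin d → EReal // (∀ i, x i ≠ ⊤) ∧ ∃ i, x i ≠ ⊥})

/-- Two coordinate vectors are equivalent if they differ by a real multiple of the all-ones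
vector. -/
def tropSetoid (d : ℕ) : Setoid (TropCoord d) where
  r x y := ∃ c : ℝ, ∀ i, y.1 i = x.1 i + (c : EReal)
  iseqv :=
    { refl := fun x => ⟨0, fun i => by simp⟩
      symm := by
        rintro x y ⟨c, h⟩
        refine ⟨-c, fun i => ?_⟩
        rw [h i, add_assoc, ← EReal.coe_add]
        simp
      trans := by
        rintro x y z ⟨c, h⟩ ⟨c', h'⟩
        refine ⟨c + c', fun i => ?_⟩
        rw [h' i, h i, add_assoc, ← EReal.coe_add] }

/-- The `(d-1)`-dimensional max-tropical projective space
`((ℝ ∪ {-∞})^d \ {-∞ 𝟏}) / ℝ 𝟏`. -/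
def TropProj (d : ℕ) : Type := Quotient (tropSetoid d)

/-- The quotient topology. -/
instance (d : ℕ) : TopologicalSpace (TropProj d) :=
  inferInstanceAs (TopologicalSpace (Quotient (tropSetoid d)))

theorem ereal_shift_le_shift_iff (a b : EReal) (c v w : ℝ) :
    a + (c : EReal) - (v : EReal) ≤ b + (c : EReal) - (w : EReal) ↔
      a - (v : EReal) ≤ b - (w : EReal) := by
  have h : ∀ (t : EReal) (u : ℝ), t + (c : EReal) - (u : EReal) = (t - (u : EReal)) + (c : EReal) :=
    fun t u => by rw [sub_eq_add_neg, sub_eq_add_neg, add_right_comm]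
  rw [h, h]
  constructor
  · intro hle
    have h2 := add_le_add_left hle ((-c : ℝ) : EReal)
    rw [add_assoc, add_assoc, ← EReal.coe_add, add_neg_cancel, EReal.coe_zero, add_zero,
      add_zero] at h2
    exact h2
  · intro hle
    exact add_le_add_left hle _

/-- The stratum of a point: the set `Z` of coordinates equal to `-∞`. -/
def tropStratum {d : ℕ} (p : TropProj d) : Set (Fin d) :=
  Quotient.lift (s := tropSetoid d) (fun x : TropCoord d => {i : Fin d | x.1 i = ⊥})
    (by
      rintro x y ⟨c, h⟩
      ext i
      simp only [Set.mem_ofPred_eq, h i]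
      rw [EReal.add_eq_bot_iff]
      simp) p

/-- The covector `(G_1(p), …, G_d(p))` of a point with respect to the columns of `V`, where
`G_i(p)` is the set of all `j` for which the minimum of `x_k - V_{kj}` over all `k` is attained
at `k = i`. -/
def tropCovector {d n : ℕ} (V : Matrix (Fin d) (Fin n) ℝ) (p : TropProj d) (i : Fin d) :
    Set (Fin n) :=
  Quotient.lift (s := tropSetoid d)
    (fun x : TropCoord d =>
      {j : Fin n | ∀ k, x.1 i - (V i j : EReal) ≤ x.1 k - (V k j : EReal)})
    (by
      rintro x y ⟨c, h⟩
      ext j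
      simp only [Set.mem_ofPred_eq, h, ereal_shift_le_shift_iff]) p

/-- The covector cell of `p` inside the relatively open stratum of `p`: all points of that
stratum whose covector contains the covector of `p`.  For `p` in the tropical projective torus
(all coordinates real) this is the cell `X_H` with `H` the covector of `p`. -/
def covectorCell {d n : ℕ} (V : Matrix (Fin d) (Fin n) ℝ) (p : TropProj d) :
    Set (TropProj d) :=
  {q | tropStratum q = tropStratum p ∧ ∀ i, tropCovector V p i ⊆ tropCovector V q i}

/-- The (nonempty closed) cells of the covector decomposition of tropical projective space: the
closures in tropical projective space of the covector cells of all strata.  As a subtype, it is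
partially ordered by inclusion. -/
def covectorDecomposition {d n : ℕ} (V : Matrix (Fin d) (Fin n) ℝ) : Set (Set (TropProj d)) :=
  {X | ∃ p : TropProj d, X = closure (covectorCell V p)}

/-! ### The dome -/

/-- The product of the min-tropical linear forms with coefficients given by the negatives of the
columns of `V`, i.e. the ordinary sum over `j` of `min_i (x_i - V_{ij})`. -/
noncomputable def tropProductForm {d n : ℕ} (V : Matrix (Fin d) (Fin n) ℝ) (x : Fin d → ℝ) : ℝ :=
  ∑ j, ⨅ i, (x i - V i j)

/-- The space `(ℝ^d × ℝ) / ℝ(𝟏, n)` in which the dome lives. -/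
abbrev DomeSpace (d n : ℕ) : Type :=
  ((Fin d → ℝ) × ℝ) ⧸ Submodule.span ℝ {((fun _ => 1, (n : ℝ)) : (Fin d → ℝ) × ℝ)}

/-- The dome `{(x, s) | s ≤ L_V(x)}`, modulo its lineality space `ℝ(𝟏, n)`. -/
def dome {d n : ℕ} (V : Matrix (Fin d) (Fin n) ℝ) : Set (DomeSpace d n) :=
  (Submodule.mkQ _) '' {z : (Fin d → ℝ) × ℝ | z.2 ≤ tropProductForm V z.1}

/-! ### Projective transformations and the face at infinity -/

/-- The recession cone of a convex set. -/
def recCone {W : Type*} [AddCommGroup W] [Module ℝ W] (P : Set W) : Set W :=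
  {v | ∀ p ∈ P, ∀ t : ℝ, 0 ≤ t → p + t • v ∈ P}

/-- The point with homogeneous coordinates `z`. -/
noncomputable def dehomogenize {E : Type*} [AddCommGroup E] [Module ℝ E] (z : E × ℝ) : E :=
  z.2⁻¹ • z.1

/-- The linear isomorphism `T` induces a projective transformation which is defined on all of `P`
and maps `P` to a bounded set.  (The sign is a normalization: `T` and `-T` induce the same
projective transformation.) -/
def IsBoundedProjective {W : Type*} [AddCommGroup W] [Module ℝ W] {d : ℕ}
    (T : (W × ℝ) ≃ₗ[ℝ] ((Fin d → ℝ) × ℝ)) (P : Set W) : Prop :=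
  (∀ p ∈ P, 0 < (T (p, 1)).2) ∧
    Bornology.IsBounded ((fun p => dehomogenize (T (p, 1))) '' P)

/-- The compact convex set projectively equivalent to `P` via `T`: the closure of the image. -/
noncomputable def projectiveModel {W : Type*} [AddCommGroup W] [Module ℝ W] {d : ℕ}
    (T : (W × ℝ) ≃ₗ[ℝ] ((Fin d → ℝ) × ℝ)) (P : Set W) : Set (Fin d → ℝ) :=
  closure ((fun p => dehomogenize (T (p, 1))) '' P)

/-- The face at infinity: the image of the recession cone of `P`, whose nonzero vectors `v` are
read as the points at infinity with homogeneous coordinates `(v, 0)`. -/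
noncomputable def faceAtInfinity {W : Type*} [AddCommGroup W] [Module ℝ W] {d : ℕ}
    (T : (W × ℝ) ≃ₗ[ℝ] ((Fin d → ℝ) × ℝ)) (P : Set W) : Set (Fin d → ℝ) :=
  (fun v => dehomogenize (T (v, 0))) '' (recCone P \ {0})

/-! ### Polytopes and Schlegel diagrams -/

/-- A polytope is the convex hull of finitely many points. -/
def IsPolytope {d : ℕ} (Q : Set (Fin d → ℝ)) : Prop :=
  ∃ S : Set (Fin d → ℝ), S.Finite ∧ Q = convexHull ℝ S

/-- A facet of `Q` is a nonempty face whose dimension is one less than that of `Q`. -/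
def IsFacet {d : ℕ} (Q F : Set (Fin d → ℝ)) : Prop :=
  IsExposed ℝ Q F ∧ F.Nonempty ∧
    Module.finrank ℝ (vectorSpan ℝ F) + 1 = Module.finrank ℝ (vectorSpan ℝ Q)

/-- `F` is a simplex of dimension `m - 1`: the convex hull of `m` affinely independent points. -/
def IsSimplex {d : ℕ} (m : ℕ) (F : Set (Fin d → ℝ)) : Prop :=
  ∃ p : Fin m → (Fin d → ℝ), AffineIndependent ℝ p ∧ F = convexHull ℝ (Set.range p)

/-- The point `y` lies beyond the facet `F` of the full-dimensional polytope `Q`: it violates the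
inequality defining `F`, and it strictly satisfies the inequalities defining all other facets. -/
def IsBeyond {d : ℕ} (Q F : Set (Fin d → ℝ)) (y : Fin d → ℝ) : Prop :=
  ∀ G, IsFacet Q G → ∀ (l : StrongDual ℝ (Fin d → ℝ)) (c : ℝ),
    (∀ x ∈ Q, l x ≤ c) → G = {x ∈ Q | l x = c} →
      (G = F → c < l y) ∧ (G ≠ F → l y < c)

/-- The image of `G` under the central projection from `y` to the affine span of `F`: a point `x`
is mapped to the intersection of the line through `y` and `x` with the affine span of `F`. -/
def centralProjection {d : ℕ} (y : Fin d → ℝ) (F G : Set (Fin d → ℝ)) : Set (Fin d → ℝ) :=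
  {z | z ∈ affineSpan ℝ F ∧ ∃ x ∈ G, z ∈ affineSpan ℝ ({y, x} : Set (Fin d → ℝ))}

/-- The (nonempty) cells of the Schlegel diagram of `Q` based at the facet `F`, for the centre `y`
of projection: the projections of the nonempty proper faces of `Q` other than `F`.  As a subtype,
it is partially ordered by inclusion. -/
def schlegelDiagram {d : ℕ} (Q F : Set (Fin d → ℝ)) (y : Fin d → ℝ) :
    Set (Set (Fin d → ℝ)) :=
  {X | ∃ G, IsExposed ℝ Q G ∧ G.Nonempty ∧ G ≠ Q ∧ G ≠ F ∧ X = centralProjection y F G}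

/-! A sum of minima is the minimum, over all maps `φ : Fin n → Fin d`, of the sums of the selected
terms. Modulo its lineality the cone over the dome is therefore cut out by `t ≥ 0` and `∑ j, (u (φ
j) - V (φ j) j * t) ≥ 0`, one form for each `φ` (`domeForm`). For an admissible transformation the
new last coordinate is positive on all nonzero vectors of this cone (`snd_pos_of_forms_nonneg`). So
`Q` is the section of the cone where that coordinate is 1, and `E_∞` is its part with `t = 0`, a
section of the nonnegative orthant.

A nonempty face of `Q` is determined by the forms active at a relative interior point, and it is
proper and different from `E_∞` exactly when some `φ` is active there. If `t > 0`, such a point is a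
point `x` of the torus, shifted so that its least form is 0, and `φ` is active iff `j` lies in
`G_{φ(j)}(x)` for all `j`. If `t = 0`, the zero set of `u` is a nonempty stratum `Z`, and `φ` is
active iff its values lie in `Z`. This is the same condition, because on such a stratum `G_i` is
everything for `i ∈ Z` and empty otherwise. Thus active sets encode pairs (stratum, covector), and
inclusions between them match (`Corresponds.forall_iff`).

The closure of a covector cell consists of all points with larger or equal stratum and covector
(`closure_covectorCell`), so cells and faces carry the same order. Projecting from `y` preserves and
reflects inclusions, since a ray from `y` leaves `Q` where it meets a face of the diagram
(`IsBeyond.centralProjection_subset_iff`). -/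

/-! ### Polyhedra given by finitely many affine inequalities -/

/-- The polyhedron on which all functions of the family `b` are nonnegative. -/
def polyhedron {κ : Type*} {d : ℕ} (b : κ → (Fin d → ℝ) →ᵃ[ℝ] ℝ) : Set (Fin d → ℝ) :=
  {x | ∀ k, 0 ≤ b k x}

/-- The points of the polyhedron satisfying with equality all inequalities that are active
at `g`. -/
def activeFace {κ : Type*} {d : ℕ} (b : κ → (Fin d → ℝ) →ᵃ[ℝ] ℝ) (g : Fin d → ℝ) :
    Set (Fin d → ℝ) :=
  {x | x ∈ polyhedron b ∧ ∀ k, b k g = 0 → b k x = 0}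

theorem affineMap_lineMap {d : ℕ} (f : (Fin d → ℝ) →ᵃ[ℝ] ℝ) (x y : Fin d → ℝ) (t : ℝ) :
    f (AffineMap.lineMap x y t) = (1 - t) * f x + t * f y := by
  rw [AffineMap.apply_lineMap, AffineMap.lineMap_apply_ring]

theorem affineMap_eq_linear_add {d : ℕ} (f : (Fin d → ℝ) →ᵃ[ℝ] ℝ) (x : Fin d → ℝ) :
    f x = f.linear x + f 0 := by
  have h := f.linearMap_vsub x 0
  simp only [vsub_eq_sub, sub_zero] at h
  rw [h]; ring

theorem affineMap_sum_apply {ι : Type*} {d : ℕ} (s : Finset ι) (b : ι → (Fin d → ℝ) →ᵃ[ℝ] ℝ)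
    (x : Fin d → ℝ) : (∑ k ∈ s, b k) x = ∑ k ∈ s, b k x := by
  classical
  induction s using Finset.induction_on with
  | empty => simp
  | insert a s ha ih => rw [Finset.sum_insert ha, Finset.sum_insert ha, AffineMap.coe_add,
      Pi.add_apply, ih]

/-- The affine function `c - l`. -/
noncomputable def constSub {d : ℕ} (l : StrongDual ℝ (Fin d → ℝ)) (c : ℝ) :
    (Fin d → ℝ) →ᵃ[ℝ] ℝ :=
  AffineMap.const ℝ _ c - l.toLinearMap.toAffineMap

@[simp] theorem constSub_apply {d : ℕ} (l : StrongDual ℝ (Fin d → ℝ)) (c : ℝ)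
    (x : Fin d → ℝ) : constSub l c x = c - l x := by
  simp [constSub]

theorem exists_constSub_eq {d : ℕ} (f : (Fin d → ℝ) →ᵃ[ℝ] ℝ) :
    ∃ (l : StrongDual ℝ (Fin d → ℝ)) (c : ℝ), ∀ x, f x = c - l x := by
  refine ⟨-LinearMap.toContinuousLinearMap f.linear, f 0, fun x => ?_⟩
  rw [affineMap_eq_linear_add f x]
  simp [add_comm]

theorem continuous_affineMap {d : ℕ} (f : (Fin d → ℝ) →ᵃ[ℝ] ℝ) : Continuous f :=
  f.continuous_of_finiteDimensional

theorem isExposed_zeroSet {d : ℕ} {Q : Set (Fin d → ℝ)} (f : (Fin d → ℝ) →ᵃ[ℝ] ℝ)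
    (hf : ∀ x ∈ Q, 0 ≤ f x) : IsExposed ℝ Q {x | x ∈ Q ∧ f x = 0} := by
  rintro ⟨x₀, hx₀, h₀⟩
  obtain ⟨l, c, hl⟩ := exists_constSub_eq f
  refine ⟨l, ?_⟩
  ext x
  simp only [Set.mem_ofPred_eq]
  refine and_congr_right fun hx => ⟨fun h y hy => ?_, fun h => ?_⟩
  · have := hf y hy
    rw [hl] at h this
    linarith
  · have h1 := h x₀ hx₀
    have h2 := hf x hx
    rw [hl] at h₀ h2 ⊢
    linarith

theorem IsExposed.exists_affine {d : ℕ} {Q G : Set (Fin d → ℝ)} (hG : IsExposed ℝ Q G)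
    (hne : G.Nonempty) :
    ∃ f : (Fin d → ℝ) →ᵃ[ℝ] ℝ, (∀ x ∈ Q, 0 ≤ f x) ∧ G = {x | x ∈ Q ∧ f x = 0} := by
  obtain ⟨l, hl⟩ := hG hne
  obtain ⟨x₀, hx₀⟩ := hne
  have h₀ := hx₀
  rw [hl] at h₀
  refine ⟨constSub l (l x₀), fun x hx => ?_, ?_⟩
  · have := h₀.2 x hx
    simpa using this
  · rw [hl]
    ext x
    simp only [Set.mem_ofPred_eq, constSub_apply]
    refine and_congr_right fun hx => ⟨fun h => ?_, fun h y hy => ?_⟩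
    · linarith [h x₀ h₀.1, h₀.2 x hx]
    · linarith [h₀.2 y hy]

section Polyhedron

variable {κ : Type*} {d : ℕ} {b : κ → (Fin d → ℝ) →ᵃ[ℝ] ℝ}

theorem convex_polyhedron : Convex ℝ (polyhedron b) := by
  intro x hx y hy s t hs ht hst k
  have : s • x + t • y = AffineMap.lineMap x y t := by
    rw [AffineMap.lineMap_apply_module, ← hst, add_sub_cancel_right]
  rw [this, affineMap_lineMap, ← hst, add_sub_cancel_right]
  exact add_nonneg (mul_nonneg hs (hx k)) (mul_nonneg ht (hy k))

theorem isClosed_polyhedron : IsClosed (polyhedron b) := by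
  have : polyhedron b = ⋂ k, {x | 0 ≤ b k x} := by ext; simp [polyhedron]
  rw [this]
  exact isClosed_iInter fun k => isClosed_le continuous_const (continuous_affineMap _)

theorem lineMap_mem_polyhedron {x y : Fin d → ℝ} (hx : x ∈ polyhedron b)
    (hy : y ∈ polyhedron b) {t : ℝ} (h0 : 0 ≤ t) (h1 : t ≤ 1) :
    AffineMap.lineMap x y t ∈ polyhedron b := by
  intro k
  rw [affineMap_lineMap]
  exact add_nonneg (mul_nonneg (by linarith) (hx k)) (mul_nonneg h0 (hy k))

/-- Constraints active at `g` vanish on the whole line through `g` and `x`; the finitely many others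
are positive at `g` and survive a short step past `g`, away from `x`. -/
theorem exists_lineMap_neg_mem_polyhedron [Finite κ] {g x : Fin d → ℝ} (hg : g ∈ polyhedron b)
    (h : ∀ k, b k g = 0 → b k x = 0) :
    ∃ ε : ℝ, 0 < ε ∧ AffineMap.lineMap g x (-ε) ∈ polyhedron b := by
  have key : ∀ᶠ ε : ℝ in nhdsWithin 0 (Set.Ioi 0),
      ∀ k, 0 ≤ b k (AffineMap.lineMap g x (-ε)) := by
    rw [Filter.eventually_all]
    intro k
    simp only [affineMap_lineMap]
    rcases (hg k).eq_or_lt with h0 | h0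
    · filter_upwards with ε
      rw [h k h0.symm, ← h0]
      simp
    · have hc : Continuous fun ε : ℝ => (1 - -ε) * b k g + -ε * b k x := by fun_prop
      have ht : Filter.Tendsto (fun ε : ℝ => (1 - -ε) * b k g + -ε * b k x) (nhds 0)
          (nhds (b k g)) := by
        simpa using hc.tendsto 0
      filter_upwards [(ht.mono_left nhdsWithin_le_nhds).eventually (lt_mem_nhds h0)] with ε hε
      exact hε.le
  obtain ⟨ε, h1, h2⟩ := (key.and self_mem_nhdsWithin).exists
  exact ⟨ε, h2, h1⟩

/-- The point `g` is interior to a segment of the polyhedron ending at `x`, and a nonnegative affine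
function that vanishes inside a segment vanishes on all of it. -/
theorem eq_zero_of_active [Finite κ] {f : (Fin d → ℝ) →ᵃ[ℝ] ℝ}
    (hf : ∀ x ∈ polyhedron b, 0 ≤ f x) {g x : Fin d → ℝ} (hg : g ∈ polyhedron b)
    (hfg : f g = 0) (hx : x ∈ polyhedron b) (h : ∀ k, b k g = 0 → b k x = 0) : f x = 0 := by
  obtain ⟨ε, hε, hmem⟩ := exists_lineMap_neg_mem_polyhedron hg h
  have h1 := hf _ hmem
  rw [affineMap_lineMap, hfg] at h1
  have h2 := hf x hx
  by_contra h3
  have : 0 < ε * f x := mul_pos hε (lt_of_le_of_ne h2 (Ne.symm h3))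
  linarith

theorem isExposed_activeFace [Finite κ] (g : Fin d → ℝ) :
    IsExposed ℝ (polyhedron b) (activeFace b g) := by
  classical
  have := Fintype.ofFinite κ
  -- The sum of the constraints active at `g` is an exposing function.
  have hs : ∀ x ∈ polyhedron b, 0 ≤ (∑ k ∈ Finset.univ.filter fun k => b k g = 0, b k) x := by
    intro x hx
    rw [affineMap_sum_apply]
    exact Finset.sum_nonneg fun k _ => hx k
  convert isExposed_zeroSet _ hs using 1
  ext x
  simp only [activeFace, Set.mem_ofPred_eq, affineMap_sum_apply]
  refine and_congr_right fun hx => ?_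
  rw [Finset.sum_eq_zero_iff_of_nonneg fun k _ => hx k]
  simp

theorem IsExposed.exists_eq_activeFace [Finite κ] {G : Set (Fin d → ℝ)}
    (hG : IsExposed ℝ (polyhedron b) G) (hne : G.Nonempty) :
    ∃ g ∈ G, G = activeFace b g := by
  classical
  have := Fintype.ofFinite κ
  obtain ⟨f, hf, rfl⟩ := hG.exists_affine hne
  -- A point with the fewest active constraints acts as a relative interior point: at the midpoint
  -- of `g` and `x` only constraints active at both remain, so minimality makes each constraint
  -- active at `g` active at `x`.
  obtain ⟨g, hg, hmin⟩ := (measure fun x : Fin d → ℝ =>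
    (Finset.univ.filter fun k => b k x = 0).card).wf.has_min _ hne
  refine ⟨g, hg, Set.Subset.antisymm (fun x hx => ⟨hx.1, fun k hk => ?_⟩) fun x hx =>
    ⟨hx.1, eq_zero_of_active hf hg.1 hg.2 hx.1 hx.2⟩⟩
  have hm := hmin (AffineMap.lineMap g x (1 / 2 : ℝ))
    ⟨lineMap_mem_polyhedron hg.1 hx.1 (by norm_num) (by norm_num), by
      rw [affineMap_lineMap, hg.2, hx.2]; ring⟩
  simp only [WellFoundedRelation.rel, InvImage, not_lt] at hm
  have hsub : ∀ k, b k (AffineMap.lineMap g x (1 / 2 : ℝ)) = 0 → b k g = 0 ∧ b k x = 0 := by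
    intro k hk
    rw [affineMap_lineMap] at hk
    have h1 := hg.1 k
    have h2 := hx.1 k
    constructor <;> linarith
  have heq := Finset.eq_of_subset_of_card_le (fun k hk => by
    simp only [Finset.mem_filter, Finset.mem_univ, true_and] at hk ⊢
    exact (hsub k hk).1) hm
  have hk' : k ∈ Finset.univ.filter fun k => b k g = 0 := by simpa using hk
  rw [← heq] at hk'
  simp only [Finset.mem_filter, Finset.mem_univ, true_and] at hk'
  exact (hsub k hk').2

theorem activeFace_subset_iff {g g' : Fin d → ℝ} (hg : g ∈ polyhedron b) :
    activeFace b g ⊆ activeFace b g' ↔ ∀ k, b k g' = 0 → b k g = 0 :=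
  ⟨fun h => (h ⟨hg, fun _ hk => hk⟩).2, fun h _ hx => ⟨hx.1, fun k hk => hx.2 k (h k hk)⟩⟩

theorem isPolytope_polyhedron [Finite κ] (hb : Bornology.IsBounded (polyhedron b)) :
    IsPolytope (polyhedron b) := by
  have hc : IsCompact (polyhedron b) := Metric.isCompact_of_isClosed_isBounded
    isClosed_polyhedron hb
  have hfin : (Set.extremePoints ℝ (polyhedron b)).Finite := by
    refine Set.Finite.of_injOn (f := fun x => {k | b k x = 0}) (t := Set.univ)
      (fun _ _ => Set.mem_univ _) ?_ Set.finite_univ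
    intro x hx y hy hxy
    have hact : ∀ k, b k x = 0 → b k y = 0 := fun k hk => (Set.ext_iff.1 hxy k).1 hk
    -- Extreme points are determined by their active sets: otherwise `x` would lie between `y` and a
    -- point of the polyhedron slightly past `x`.
    obtain ⟨ε, hε, hmem⟩ := exists_lineMap_neg_mem_polyhedron hx.1 hact
    have hseg : x ∈ openSegment ℝ (AffineMap.lineMap x y (-ε)) y := by
      refine ⟨1 / (1 + ε), ε / (1 + ε), by positivity, by positivity, by field_simp, ?_⟩
      rw [AffineMap.lineMap_apply_module]
      ext i
      simp only [Pi.add_apply, Pi.smul_apply, smul_eq_mul]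
      field_simp
      ring
    exact ((mem_extremePoints_iff_left.1 hx).2 y hy.1 _ hmem
      (by rwa [openSegment_symm])).symm
  refine ⟨_, hfin, ?_⟩
  rw [← (hfin.isCompact_convexHull ℝ).isClosed.closure_eq,
    closure_convexHull_extremePoints hc convex_polyhedron]

theorem vectorSpan_le_ker {G : Set (Fin d → ℝ)} {f : (Fin d → ℝ) →ᵃ[ℝ] ℝ}
    (hf : ∀ x ∈ G, f x = 0) : vectorSpan ℝ G ≤ LinearMap.ker f.linear := by
  rw [vectorSpan_def, Submodule.span_le]
  rintro _ ⟨x, hx, y, hy, rfl⟩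
  simp [f.linearMap_vsub, hf x hx, hf y hy, -vsub_eq_sub]

theorem finrank_ker_linear_add_one {f : (Fin d → ℝ) →ᵃ[ℝ] ℝ} {x y : Fin d → ℝ}
    (h : f x ≠ f y) : Module.finrank ℝ (LinearMap.ker f.linear) + 1 = d := by
  have h0 : f.linear ≠ 0 := by
    intro h0
    apply h
    rw [affineMap_eq_linear_add f x, affineMap_eq_linear_add f y, h0]
    simp
  have := Module.Dual.finrank_ker_add_one_of_ne_zero (f := f.linear) h0
  simpa using this

/-- Two affine functions vanishing on a set of codimension one are proportional. -/
theorem mul_eq_mul_of_vanish {G : Set (Fin d → ℝ)} {f h : (Fin d → ℝ) →ᵃ[ℝ] ℝ}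
    (hG : Module.finrank ℝ (vectorSpan ℝ G) + 1 = d) (hne : G.Nonempty)
    (hf : ∀ x ∈ G, f x = 0) (hh : ∀ x ∈ G, h x = 0) {q : Fin d → ℝ} (hq : h q ≠ 0)
    (y : Fin d → ℝ) : f y * h q = f q * h y := by
  obtain ⟨g, hg⟩ := hne
  have h1 : vectorSpan ℝ G = LinearMap.ker h.linear := by
    apply Submodule.eq_of_le_of_finrank_eq (vectorSpan_le_ker hh)
    have := finrank_ker_linear_add_one (f := h) (x := q) (y := g) (by rwa [hh g hg])
    omega
  have h2 := vectorSpan_le_ker hf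
  rw [h1] at h2
  have hv : ∀ (f : (Fin d → ℝ) →ᵃ[ℝ] ℝ) x, f g = 0 → f.linear (x - g) = f x := by
    intro f x h0
    have := f.linearMap_vsub x g
    simpa [h0] using this
  have h3 : h q • (y - g) - h y • (q - g) ∈ LinearMap.ker h.linear := by
    rw [LinearMap.mem_ker, map_sub, map_smul, map_smul, hv h y (hh g hg), hv h q (hh g hg)]
    simp [mul_comm]
  have h4 := h2 h3
  rw [LinearMap.mem_ker, map_sub, map_smul, map_smul, hv f y (hf g hg), hv f q (hf g hg)] at h4
  simp only [smul_eq_mul] at h4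
  linarith

theorem finrank_vectorSpan_polyhedron [Finite κ] {q : Fin d → ℝ} (hq : ∀ k, 0 < b k q) :
    Module.finrank ℝ (vectorSpan ℝ (polyhedron b)) = d := by
  have hopen : IsOpen {x | ∀ k, 0 < b k x} := by
    have : {x | ∀ k, 0 < b k x} = ⋂ k, {x | 0 < b k x} := by ext; simp
    rw [this]
    exact isOpen_iInter_of_finite fun k => isOpen_lt continuous_const (continuous_affineMap _)
  have h1 := hopen.affineSpan_eq_top ⟨q, hq⟩
  have h2 : affineSpan ℝ (polyhedron b) = ⊤ := by
    rw [eq_top_iff, ← h1]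
    exact affineSpan_mono ℝ fun x hx k => (hx k).le
  rw [← direction_affineSpan, h2, AffineSubspace.direction_top, finrank_top]
  simp

/-- The constraints `J` together with `k` already describe the polyhedron. As all of `J` is strict
at `z`, short steps from `z` in any direction of the hyperplane `b k = 0` stay in the face, which
therefore spans that hyperplane. -/
theorem isFacet_zeroSet [Finite κ] {q : Fin d → ℝ} (hq : ∀ k, 0 < b k q) (k : κ)
    {J : Set κ} (hJ : ∀ x, 0 ≤ b k x → (∀ m ∈ J, 0 ≤ b m x) → x ∈ polyhedron b)
    {z : Fin d → ℝ} (hz : b k z = 0) (hzJ : ∀ m ∈ J, 0 < b m z) :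
    IsFacet (polyhedron b) {x | x ∈ polyhedron b ∧ b k x = 0} := by
  have hzQ : z ∈ polyhedron b := hJ z hz.ge fun m hm => (hzJ m hm).le
  refine ⟨isExposed_zeroSet _ fun x hx => hx k, ⟨z, hzQ, hz⟩, ?_⟩
  rw [finrank_vectorSpan_polyhedron hq]
  refine Eq.trans ?_ (finrank_ker_linear_add_one (f := b k) (x := q) (y := z)
    (by rw [hz]; exact (hq k).ne'))
  rw [show vectorSpan ℝ {x | x ∈ polyhedron b ∧ b k x = 0} = LinearMap.ker (b k).linear from ?_]
  refine le_antisymm (vectorSpan_le_ker fun x hx => hx.2) fun v hv => ?_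
  have hv0 : ∀ ε : ℝ, b k (z + ε • v) = 0 := by
    intro ε
    have h := (b k).map_vadd z (ε • v)
    rw [vadd_eq_add, add_comm, map_smul, LinearMap.mem_ker.1 hv, hz] at h
    simpa using h
  have key : ∀ᶠ ε : ℝ in nhdsWithin 0 (Set.Ioi 0), ∀ m ∈ J, 0 ≤ b m (z + ε • v) := by
    have : ∀ᶠ ε : ℝ in nhdsWithin 0 (Set.Ioi 0), ∀ m, m ∈ J → 0 ≤ b m (z + ε • v) := by
      rw [Filter.eventually_all]
      intro m
      by_cases hm : m ∈ J
      · have hc : Continuous fun ε : ℝ => b m (z + ε • v) :=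
          (continuous_affineMap _).comp (by fun_prop)
        have ht : Filter.Tendsto (fun ε : ℝ => b m (z + ε • v)) (nhds 0) (nhds (b m z)) := by
          simpa using hc.tendsto 0
        filter_upwards [(ht.mono_left nhdsWithin_le_nhds).eventually
          (lt_mem_nhds (hzJ m hm))] with ε hε _
        exact hε.le
      · filter_upwards with ε h using absurd h hm
    exact this
  obtain ⟨ε, h1, h2⟩ := (key.and self_mem_nhdsWithin).exists
  have h3 : (z + ε • v) -ᵥ z ∈ vectorSpan ℝ {x | x ∈ polyhedron b ∧ b k x = 0} :=
    vsub_mem_vectorSpan ℝ ⟨hJ _ (hv0 ε).ge h1, hv0 ε⟩ ⟨hzQ, hz⟩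
  rw [vsub_eq_sub, add_sub_cancel_left] at h3
  have h4 := Submodule.smul_mem _ ε⁻¹ h3
  rwa [smul_smul, inv_mul_cancel₀ (ne_of_gt h2), one_smul] at h4

end Polyhedron

/-! ### Points beyond a facet and projection from them. -/

theorem isBeyond_iff_affine {d : ℕ} {Q F : Set (Fin d → ℝ)} {y : Fin d → ℝ} :
    IsBeyond Q F y ↔ ∀ G, IsFacet Q G → ∀ f : (Fin d → ℝ) →ᵃ[ℝ] ℝ, (∀ x ∈ Q, 0 ≤ f x) →
      G = {x | x ∈ Q ∧ f x = 0} → (G = F → f y < 0) ∧ (G ≠ F → 0 < f y) := by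
  constructor
  · intro h G hG f hf hGf
    obtain ⟨l, c, hl⟩ := exists_constSub_eq f
    have := h G hG l c (fun x hx => by have := hf x hx; rw [hl] at this; linarith) (by
      rw [hGf]
      ext x
      simp only [Set.mem_ofPred_eq]
      refine and_congr_right fun _ => ?_
      rw [hl, sub_eq_zero, eq_comm])
    rw [hl]
    exact ⟨fun h => by linarith [this.1 h], fun h => by linarith [this.2 h]⟩
  · intro h G hG l c hl hGl
    have := h G hG (constSub l c) (fun x hx => by simpa using hl x hx) (by
      rw [hGl]
      ext x
      simp only [Set.mem_ofPred_eq, constSub_apply]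
      refine and_congr_right fun _ => ?_
      rw [sub_eq_zero, eq_comm])
    simpa using this

section Beyond

variable {Φ : Type*} [Finite Φ] {d : ℕ} {b : Option Φ → (Fin d → ℝ) →ᵃ[ℝ] ℝ}

/-- The face of the polyhedron cut out by the distinguished inequality. -/
def baseFace {Φ : Type*} {d : ℕ} (b : Option Φ → (Fin d → ℝ) →ᵃ[ℝ] ℝ) : Set (Fin d → ℝ) :=
  {x | x ∈ polyhedron b ∧ b none x = 0}

theorem isFacet_baseFace {q z : Fin d → ℝ} (hq : ∀ k, 0 < b k q) (hz : b none z = 0)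
    (hz' : ∀ φ, 0 < b (some φ) z) : IsFacet (polyhedron b) (baseFace b) := by
  refine isFacet_zeroSet hq none (J := Set.range some) (fun x h0 h k => ?_) hz ?_
  · cases k with
    | none => exact h0
    | some φ => exact h _ ⟨φ, rfl⟩
  · rintro _ ⟨φ, rfl⟩
    exact hz' φ

theorem zeroSet_eq_polyhedron {κ : Type*} [Finite κ] {b : κ → (Fin d → ℝ) →ᵃ[ℝ] ℝ}
    {f : (Fin d → ℝ) →ᵃ[ℝ] ℝ} (hf : ∀ x ∈ polyhedron b, 0 ≤ f x) {q : Fin d → ℝ}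
    (hq : ∀ k, 0 < b k q) (h0 : f q = 0) :
    {x | x ∈ polyhedron b ∧ f x = 0} = polyhedron b := by
  refine Set.Subset.antisymm (fun x hx => hx.1) fun x hx => ⟨hx, ?_⟩
  exact eq_zero_of_active hf (fun k => (hq k).le) h0 hx fun k hk => absurd hk (hq k).ne'

/-- Every facet lies in the zero set of some `b k`, and an affine function defining the facet is
then a positive multiple of `b k`, compared at the interior point `q`. -/
theorem isBeyond_baseFace {q y : Fin d → ℝ} (hq : ∀ k, 0 < b k q) (hy : b none y < 0)
    (hy' : ∀ φ, 0 < b (some φ) y) : IsBeyond (polyhedron b) (baseFace b) y := by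
  rw [isBeyond_iff_affine]
  intro G hG f hf hGf
  have hdim := finrank_vectorSpan_polyhedron hq
  have hGd := hG.2.2
  rw [hdim] at hGd
  have hvan : ∀ x ∈ G, f x = 0 := fun x hx => by rw [hGf] at hx; exact hx.2
  have hqQ : q ∈ polyhedron b := fun k => (hq k).le
  have hGQ : G ≠ polyhedron b := by
    rintro rfl
    omega
  have hfq : 0 < f q := by
    refine lt_of_le_of_ne (hf q hqQ) fun h0 => hGQ ?_
    rw [hGf, zeroSet_eq_polyhedron hf hq h0.symm]
  have hprop : ∀ k, (∀ x ∈ G, b k x = 0) → ∀ y, f y * b k q = f q * b k y := fun k hk y =>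
    mul_eq_mul_of_vanish hGd hG.2.1 hvan hk (hq k).ne' y
  have hneg : ∀ {k y}, f y * b k q = f q * b k y → b k y < 0 → f y < 0 := by
    intro k y h h0
    have : f y * b k q < 0 := by rw [h]; exact mul_neg_of_pos_of_neg hfq h0
    exact neg_of_mul_neg_left this (hq k).le
  have hpos : ∀ {k y}, f y * b k q = f q * b k y → 0 < b k y → 0 < f y := by
    intro k y h h0
    have : 0 < f y * b k q := by rw [h]; exact mul_pos hfq h0
    exact pos_of_mul_pos_left this (hq k).le
  constructor
  · rintro rfl
    exact hneg (hprop none (fun x hx => hx.2) y) hy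
  · intro hne
    obtain ⟨g, hg, hGg⟩ := hG.1.exists_eq_activeFace hG.2.1
    have hgn : b none g ≠ 0 := by
      intro h0
      have hGF : ∀ x ∈ G, b none x = 0 := fun x hx => by rw [hGg] at hx; exact hx.2 _ h0
      apply hne
      refine Set.Subset.antisymm (fun x hx => ⟨hG.1.subset hx, hGF x hx⟩) fun x hx => ?_
      rw [hGf]
      refine ⟨hx.1, ?_⟩
      have := hprop none hGF x
      rw [hx.2, mul_zero] at this
      exact (mul_eq_zero.1 this).resolve_right (hq none).ne'
    have : ∃ φ, b (some φ) g = 0 := by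
      by_contra! hcon
      apply hGQ
      rw [hGg]
      refine Set.Subset.antisymm (fun x hx => hx.1) fun x hx => ⟨hx, fun k hk => ?_⟩
      cases k with
      | none => exact absurd hk hgn
      | some φ => exact absurd hk (hcon φ)
    obtain ⟨φ, hφ⟩ := this
    exact hpos (hprop (some φ) (fun x hx => by rw [hGg] at hx; exact hx.2 _ hφ) y) (hy' φ)

/-- A point beyond the base facet violates the distinguished inequality and strictly satisfies
all other inequalities of an irredundant description. -/
theorem IsBeyond.exists_irredundant {q z y : Fin d → ℝ} (hq : ∀ k, 0 < b k q)
    (hz : b none z = 0) (hz' : ∀ φ, 0 < b (some φ) z)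
    (hy : IsBeyond (polyhedron b) (baseFace b) y) :
    ∃ J : Finset Φ, polyhedron (fun k : Option J => b (k.map Subtype.val)) = polyhedron b ∧
      b none y < 0 ∧ ∀ φ ∈ J, 0 < b (some φ) y := by
  classical
  have := Fintype.ofFinite Φ
  rw [isBeyond_iff_affine] at hy
  let S : Set (Finset Φ) :=
    {J | ∀ x, 0 ≤ b none x → (∀ φ ∈ J, 0 ≤ b (some φ) x) → x ∈ polyhedron b}
  have hS : S.Nonempty := ⟨Finset.univ, fun x h0 h k => by
    cases k with
    | none => exact h0
    | some φ => exact h φ (Finset.mem_univ _)⟩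
  -- In a smallest sufficient subfamily each remaining inequality defines a facet, so being beyond
  -- gives its sign at `y`.
  obtain ⟨J, hJ, hmin⟩ := (measure (Finset.card : Finset Φ → ℕ)).wf.has_min S hS
  refine ⟨J, ?_, ?_, ?_⟩
  · refine Set.Subset.antisymm (fun x hx => hJ x (hx none) fun φ hφ => hx (some ⟨φ, hφ⟩))
      fun x hx k => hx _
  · exact (hy _ (isFacet_baseFace hq hz hz') (b none) (fun x hx => hx none) rfl).1 rfl
  · intro φ hφ
    have hnot : J.erase φ ∉ S := fun h => hmin _ h (Finset.card_erase_lt_of_mem hφ)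
    simp only [S, Set.mem_ofPred_eq, not_forall] at hnot
    obtain ⟨x, hx0, hx, hxQ⟩ := hnot
    have hxφ : b (some φ) x < 0 := by
      by_contra! hcon
      refine hxQ (hJ x hx0 fun ψ hψ => ?_)
      by_cases h : ψ = φ
      · rwa [h]
      · exact hx ψ (Finset.mem_erase.2 ⟨h, hψ⟩)
    have hqφ := hq (some φ)
    -- The point `x` violates only `φ` among the inequalities kept. The segment from `q` to `x`
    -- crosses the hyperplane of `φ` at a point strict for all the others.
    obtain ⟨t, ht0, ht1, ht⟩ : ∃ t : ℝ, 0 ≤ t ∧ t < 1 ∧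
        (1 - t) * b (some φ) q + t * b (some φ) x = 0 := by
      have hpos : 0 < b (some φ) q - b (some φ) x := by linarith
      refine ⟨b (some φ) q / (b (some φ) q - b (some φ) x), by positivity, ?_, ?_⟩
      · rw [div_lt_one hpos]; linarith
      · field_simp; ring
    have hw : ∀ k, 0 ≤ b k x → 0 < b k (AffineMap.lineMap q x t) := by
      intro k hk
      rw [affineMap_lineMap]
      exact add_pos_of_pos_of_nonneg (mul_pos (by linarith) (hq k)) (mul_nonneg ht0 hk)
    have hwφ : b (some φ) (AffineMap.lineMap q x t) = 0 := by rw [affineMap_lineMap, ht]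
    have hfac := isFacet_zeroSet hq (some φ) (J := insert none (some '' (J.erase φ : Set Φ)))
      (fun x h0 h => hJ x (h _ (Set.mem_insert _ _)) fun ψ hψ => by
        by_cases he : ψ = φ
        · rwa [he]
        · exact h _ (Set.mem_insert_of_mem _ ⟨ψ, by simp [he, hψ], rfl⟩)) hwφ (by
        rintro m (rfl | ⟨ψ, hψ, rfl⟩)
        · exact hw _ hx0
        · exact hw _ (hx ψ hψ))
    refine (hy _ hfac (b (some φ)) (fun x hx => hx _) rfl).2 fun heq => ?_
    have hmem : AffineMap.lineMap q x t ∈ baseFace b := by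
      rw [← heq]
      exact ⟨hJ _ (hw _ hx0).le fun ψ hψ => by
        by_cases he : ψ = φ
        · rw [he, hwφ]
        · exact (hw _ (hx ψ (Finset.mem_erase.2 ⟨he, hψ⟩))).le, hwφ⟩
    exact (hw _ hx0).ne' hmem.2

/-- A ray from a point beyond the base facet leaves the polyhedron as soon as it meets a proper
face other than the base facet. -/
theorem not_mem_polyhedron_of_mem_face {y : Fin d → ℝ} (hy' : ∀ φ, 0 < b (some φ) y)
    {G : Set (Fin d → ℝ)}
    (hG : IsExposed ℝ (polyhedron b) G) (hGQ : G ≠ polyhedron b) (hGF : G ≠ baseFace b)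
    {x : Fin d → ℝ} (hx : x ∈ G) {μ : ℝ} (hμ : 1 < μ) :
    AffineMap.lineMap y x μ ∉ polyhedron b := by
  intro hmem
  obtain ⟨f, hf, hGf⟩ := hG.exists_affine ⟨x, hx⟩
  have hxQ := hG.subset hx
  have hxf : f x = 0 := by rw [hGf] at hx; exact hx.2
  -- If the ray continued inside the polyhedron past `x`, then `x` would be strict for every `φ`,
  -- hence interior or relatively interior to the base facet.
  have hpos : ∀ φ, 0 < b (some φ) x := by
    intro φ
    have h1 := hmem (some φ)
    rw [affineMap_lineMap] at h1
    have h2 : 0 < (μ - 1) * b (some φ) y := mul_pos (by linarith) (hy' φ)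
    have h3 : 0 < μ * b (some φ) x := by linarith
    exact pos_of_mul_pos_right h3 (by linarith)
  have hint : ∀ w ∈ G, b none w ≠ 0 → (∀ φ, 0 < b (some φ) w) → False := by
    intro w hw h0 h1
    apply hGQ
    rw [hGf, zeroSet_eq_polyhedron hf (q := w)]
    · intro k
      cases k with
      | none => exact lt_of_le_of_ne (hG.subset hw none) (Ne.symm h0)
      | some φ => exact h1 φ
    · rw [hGf] at hw; exact hw.2
  by_cases hx0 : b none x = 0
  · apply hGF
    refine Set.Subset.antisymm (fun w hw => ⟨hG.subset hw, ?_⟩) fun w hw => ?_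
    · by_contra hne
      have hwQ := hG.subset hw
      have hwf : f w = 0 := by rw [hGf] at hw; exact hw.2
      -- A point `w` of `G` off the base facet would make the midpoint of `x` and `w` an interior
      -- point lying on `G`.
      refine hint (AffineMap.lineMap x w (1 / 2 : ℝ)) ?_ ?_ fun φ => ?_
      · rw [hGf]
        exact ⟨lineMap_mem_polyhedron hxQ hwQ (by norm_num) (by norm_num), by
          rw [affineMap_lineMap, hxf, hwf]; ring⟩
      · rw [affineMap_lineMap, hx0]
        simpa using hne
      · rw [affineMap_lineMap]
        linarith [hpos φ, hwQ (some φ)]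
    · rw [hGf]
      refine ⟨hw.1, eq_zero_of_active hf hxQ hxf hw.1 fun k hk => ?_⟩
      cases k with
      | none => exact hw.2
      | some φ => exact absurd hk (hpos φ).ne'
  · exact hint x hx hx0 hpos

/-- A point `x` of `G` and a point `x'` of `G'` with the same projection lie on one ray from `y`.
Each is where that ray leaves the polyhedron, so they coincide. -/
theorem subset_of_centralProjection_subset {y : Fin d → ℝ} (hy : b none y < 0)
    (hy' : ∀ φ, 0 < b (some φ) y) {G G' : Set (Fin d → ℝ)}
    (hG : IsExposed ℝ (polyhedron b) G) (hGQ : G ≠ polyhedron b) (hGF : G ≠ baseFace b)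
    (hG' : IsExposed ℝ (polyhedron b) G') (hGQ' : G' ≠ polyhedron b) (hGF' : G' ≠ baseFace b)
    (h : centralProjection y (baseFace b) G ⊆ centralProjection y (baseFace b) G') :
    G ⊆ G' := by
  intro x hx
  have hxQ := hG.subset hx
  have hx0 := hxQ none
  have hsp : ∀ z ∈ affineSpan ℝ (baseFace b), b none z = 0 := by
    intro z hz
    refine affineSpan_induction (p := fun z => b none z = 0) hz (fun w hw => hw.2) ?_
    intro c u v w hu hv hw
    rw [AffineMap.map_vadd, map_smul, AffineMap.linearMap_vsub, hu, hv, hw]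
    simp
  have hden : 0 < b none x - b none y := by linarith
  -- The parameter at which the segment from `y` to `x` meets `b none = 0`.
  set s : ℝ := -b none y / (b none x - b none y) with hs
  have hs0 : 0 < s := div_pos (by linarith) hden
  have hs1 : s ≤ 1 := by rw [hs, div_le_one hden]; linarith
  set z := AffineMap.lineMap y x s with hz
  have hzb : b none z = 0 := by
    rw [hz, affineMap_lineMap, hs]
    field_simp
    ring
  have hzQ : z ∈ polyhedron b := by
    intro k
    cases k with
    | none => rw [hzb]
    | some φ =>
      rw [hz, affineMap_lineMap]
      exact add_nonneg (mul_nonneg (by linarith) (hy' φ).le)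
        (mul_nonneg hs0.le (hxQ _))
  obtain ⟨hzF, x', hx', hline⟩ := h ⟨subset_affineSpan ℝ _ ⟨hzQ, hzb⟩, x, hx,
    AffineMap.lineMap_mem_affineSpan_pair _ _ _⟩
  obtain ⟨s', hs'⟩ : ∃ s' : ℝ, AffineMap.lineMap y x' s' = z := by
    rw [← vsub_vadd z y, vadd_left_mem_affineSpan_pair] at hline
    obtain ⟨r, hr⟩ := hline
    exact ⟨r, by rw [AffineMap.lineMap_apply, hr, vsub_vadd]⟩
  have hxQ' := hG'.subset hx'
  have hx0' := hxQ' none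
  -- On the opposite ray, and at `y` itself, `b none` stays negative.
  have hs0' : 0 < s' := by
    by_contra! hle
    have h1 : b none z = 0 := hzb
    rw [← hs', affineMap_lineMap] at h1
    nlinarith
  have hcomb : ∀ (u v : ℝ) (w w' : Fin d → ℝ), 0 < u →
      AffineMap.lineMap y w u = (AffineMap.lineMap y w' v : Fin d → ℝ) →
      w = AffineMap.lineMap y w' (v / u) := by
    intro u v w w' hu he
    ext i
    have hi := congrFun he i
    simp only [AffineMap.lineMap_apply_module, Pi.add_apply, Pi.smul_apply, smul_eq_mul]
      at hi ⊢
    field_simp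
    linarith
  have e1 : x' = AffineMap.lineMap y x (s / s') := hcomb s' s x' x hs0' hs'
  have e2 : x = AffineMap.lineMap y x' (s' / s) := hcomb s s' x x' hs0 hs'.symm
  rcases lt_trichotomy s s' with hlt | heq | hgt
  · refine absurd hxQ ?_
    rw [e2]
    exact not_mem_polyhedron_of_mem_face hy' hG' hGQ' hGF' hx' ((one_lt_div hs0).2 hlt)
  · rw [heq, div_self hs0'.ne', AffineMap.lineMap_apply_one] at e2
    rwa [e2]
  · refine absurd hxQ' ?_
    rw [e1]
    exact not_mem_polyhedron_of_mem_face hy' hG hGQ hGF hx ((one_lt_div hs0').2 hgt)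

theorem centralProjection_mono {y : Fin d → ℝ} {F G G' : Set (Fin d → ℝ)} (h : G ⊆ G') :
    centralProjection y F G ⊆ centralProjection y F G' := by
  rintro z ⟨h1, x, hx, h2⟩
  exact ⟨h1, x, h hx, h2⟩

/-- Being beyond says nothing about redundant inequalities, whereas
`subset_of_centralProjection_subset` needs every sign at `y`; hence the passage to an irredundant
subfamily with the same polyhedron. -/
theorem IsBeyond.centralProjection_subset_iff {q z y : Fin d → ℝ} (hq : ∀ k, 0 < b k q)
    (hz : b none z = 0) (hz' : ∀ φ, 0 < b (some φ) z)
    (hy : IsBeyond (polyhedron b) (baseFace b) y) {G G' : Set (Fin d → ℝ)}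
    (hG : IsExposed ℝ (polyhedron b) G) (hGQ : G ≠ polyhedron b) (hGF : G ≠ baseFace b)
    (hG' : IsExposed ℝ (polyhedron b) G') (hGQ' : G' ≠ polyhedron b)
    (hGF' : G' ≠ baseFace b) :
    centralProjection y (baseFace b) G ⊆ centralProjection y (baseFace b) G' ↔ G ⊆ G' := by
  refine ⟨fun h => ?_, centralProjection_mono⟩
  obtain ⟨J, hJ, h0, h1⟩ := hy.exists_irredundant hq hz hz'
  have hF : baseFace (fun k : Option J => b (k.map Subtype.val)) = baseFace b := by
    unfold baseFace
    rw [hJ]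
    rfl
  rw [← hJ] at hG hG' hGQ hGQ'
  rw [← hF] at hGF hGF' h
  exact subset_of_centralProjection_subset (b := fun k : Option J => b (k.map Subtype.val)) h0
    (fun φ => show 0 < b (some (φ : Φ)) y from h1 φ φ.2) hG hGQ hGF hG' hGQ' hGF' h

end Beyond

/-! ### Covectors -/

section Covector

variable {d n : ℕ} {V : Matrix (Fin d) (Fin n) ℝ}

/-- The class of a vector of homogeneous coordinates. -/
def TropCoord.toProj {d : ℕ} (x : TropCoord d) : TropProj d := Quotient.mk (tropSetoid d) x

theorem TropCoord.continuous_toProj : Continuous (TropCoord.toProj (d := d)) :=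
  continuous_quotient_mk'

theorem TropCoord.toProj_surjective : Function.Surjective (TropCoord.toProj (d := d)) :=
  Quotient.mk_surjective

theorem mem_tropCovector {x : TropCoord d} {i : Fin d} {j : Fin n} :
    j ∈ tropCovector V x.toProj i ↔ ∀ k, x.1 i - (V i j : EReal) ≤ x.1 k - (V k j : EReal) :=
  Iff.rfl

theorem mem_tropStratum {x : TropCoord d} {i : Fin d} :
    i ∈ tropStratum x.toProj ↔ x.1 i = ⊥ := Iff.rfl

theorem TropCoord.coe_toReal (x : TropCoord d) {i : Fin d} (h : x.1 i ≠ ⊥) :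
    ((x.1 i).toReal : EReal) = x.1 i :=
  EReal.coe_toReal (x.2.1 i) h

/-- Once some coordinate is `-∞`, the minimum is `-∞` for every `j` and is attained exactly on the
stratum. -/
theorem mem_tropCovector_of_stratum_nonempty {x : TropCoord d}
    (h : (tropStratum x.toProj).Nonempty) {i : Fin d} {j : Fin n} :
    j ∈ tropCovector V x.toProj i ↔ i ∈ tropStratum x.toProj := by
  rw [mem_tropCovector, mem_tropStratum]
  constructor
  · intro hj
    obtain ⟨k, hk⟩ := h
    rw [mem_tropStratum] at hk
    by_contra hi
    have h1 := hj k
    rw [hk, EReal.bot_sub, le_bot_iff, ← x.coe_toReal hi, ← EReal.coe_sub] at h1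
    exact EReal.coe_ne_bot _ h1
  · intro hi k
    rw [hi, EReal.bot_sub]
    exact bot_le

theorem exists_mem_tropCovector (V : Matrix (Fin d) (Fin n) ℝ) (x : TropCoord d) (j : Fin n) :
    ∃ i, j ∈ tropCovector V x.toProj i := by
  obtain ⟨i₀, -⟩ := x.2.2
  have : Nonempty (Fin d) := ⟨i₀⟩
  exact Finite.exists_min fun k => x.1 k - (V k j : EReal)

theorem continuous_ereal_sub_coe (v : ℝ) : Continuous fun a : EReal => a - (v : EReal) := by
  simp only [sub_eq_add_neg, ← EReal.coe_neg]
  rw [continuous_iff_continuousAt]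
  intro a
  have h : ContinuousAt (fun p : EReal × EReal => p.1 + p.2) (a, ((-v : ℝ) : EReal)) :=
    EReal.continuousAt_add (Or.inr (EReal.coe_ne_bot _)) (Or.inr (EReal.coe_ne_top _))
  exact ContinuousAt.comp (f := fun a : EReal => (a, ((-v : ℝ) : EReal))) h
    (by fun_prop)

theorem TropCoord.continuous_apply (i : Fin d) : Continuous fun x : TropCoord d => x.1 i :=
  (_root_.continuous_apply i).comp continuous_subtype_val

theorem isClosed_covector_ge (p : TropProj d) :
    IsClosed {q : TropProj d | tropStratum p ⊆ tropStratum q ∧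
      ∀ i, tropCovector V p i ⊆ tropCovector V q i} := by
  have hq : Topology.IsQuotientMap (TropCoord.toProj (d := d)) := isQuotientMap_quotient_mk'
  rw [← hq.isClosed_preimage]
  have : TropCoord.toProj ⁻¹' {q : TropProj d | tropStratum p ⊆ tropStratum q ∧
      ∀ i, tropCovector V p i ⊆ tropCovector V q i} =
      (⋂ i ∈ tropStratum p, {x : TropCoord d | x.1 i = ⊥}) ∩
      ⋂ i, ⋂ j ∈ tropCovector V p i, ⋂ k,
        {x : TropCoord d | x.1 i - (V i j : EReal) ≤ x.1 k - (V k j : EReal)} := by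
    ext x
    simp only [Set.mem_preimage, Set.mem_ofPred_eq, Set.mem_inter_iff, Set.mem_iInter,
      Set.subset_def, mem_tropCovector, mem_tropStratum]
  rw [this]
  refine IsClosed.inter ?_ ?_
  · exact isClosed_biInter fun i _ => isClosed_eq (TropCoord.continuous_apply i) continuous_const
  · exact isClosed_iInter fun i => isClosed_biInter fun j _ => isClosed_iInter fun k =>
      isClosed_le ((continuous_ereal_sub_coe _).comp (TropCoord.continuous_apply i))
        ((continuous_ereal_sub_coe _).comp (TropCoord.continuous_apply k))

theorem tendsto_ereal_sub_natCast (a : EReal) (ha : a ≠ ⊤) :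
    Filter.Tendsto (fun M : ℕ => a - ((M : ℝ) : EReal)) Filter.atTop (nhds ⊥) := by
  induction a with
  | bot => simp
  | top => exact absurd rfl ha
  | coe r =>
    simp only [← EReal.coe_sub]
    rw [EReal.tendsto_coe_nhds_bot_iff]
    exact Filter.tendsto_atBot_add_const_left _ r
      (Filter.tendsto_neg_atTop_atBot.comp tendsto_natCast_atTop_atTop)

theorem ereal_sub_coe_eq_bot {a : EReal} {r : ℝ} : a - (r : EReal) = ⊥ ↔ a = ⊥ := by
  induction a with
  | bot => simp
  | top => simp
  | coe s => simp only [← EReal.coe_sub, EReal.coe_ne_bot]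

theorem ereal_sub_coe_ne_top {a : EReal} (ha : a ≠ ⊤) (r : ℝ) : a - (r : EReal) ≠ ⊤ := by
  induction a with
  | bot => simp
  | top => exact absurd rfl ha
  | coe s => rw [← EReal.coe_sub]; exact EReal.coe_ne_top _

theorem closure_covectorCell (p : TropProj d) :
    closure (covectorCell V p) = {q : TropProj d | tropStratum p ⊆ tropStratum q ∧
      ∀ i, tropCovector V p i ⊆ tropCovector V q i} := by
  classical
  refine Set.Subset.antisymm ?_ ?_
  · refine closure_minimal (fun q hq => ⟨hq.1.ge, hq.2⟩) (isClosed_covector_ge p)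
  rintro q ⟨hZ, hG⟩
  by_cases hZe : tropStratum q = tropStratum p
  · exact subset_closure ⟨hZe, hG⟩
  obtain ⟨x, rfl⟩ := TropCoord.toProj_surjective p
  obtain ⟨y, rfl⟩ := TropCoord.toProj_surjective q
  have hyne : (tropStratum y.toProj).Nonempty := by
    by_contra hne
    rw [Set.not_nonempty_iff_eq_empty] at hne
    exact hZe (Set.Subset.antisymm (by simp [hne]) hZ)
  -- Keep the finite coordinates of `y` and replace its `-∞` entries by those of `x` lowered by `M`.
  -- This converges to `y`, and for large `M` it has the stratum of `x` and at least its covector.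
  let z : ℕ → TropCoord d := fun M =>
    ⟨fun i => if y.1 i = ⊥ then x.1 i - ((M : ℝ) : EReal) else y.1 i, by
      refine ⟨fun i => ?_, ?_⟩
      · dsimp only
        split_ifs
        · exact ereal_sub_coe_ne_top (x.2.1 i) _
        · exact y.2.1 i
      · obtain ⟨i, hi⟩ := y.2.2
        exact ⟨i, fun h => hi (by simpa only [if_neg hi] using h)⟩⟩
  have hz : ∀ M i, (z M).1 i = if y.1 i = ⊥ then x.1 i - ((M : ℝ) : EReal) else y.1 i :=
    fun _ _ => rfl
  have hlim : Filter.Tendsto z Filter.atTop (nhds y) := by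
    refine tendsto_subtype_rng.2 (tendsto_pi_nhds.2 fun i => ?_)
    simp only [hz]
    by_cases hi : y.1 i = ⊥
    · simp only [if_pos hi]
      rw [hi]
      exact tendsto_ereal_sub_natCast _ (x.2.1 i)
    · simp only [if_neg hi]
      exact tendsto_const_nhds
  refine mem_closure_of_tendsto ((TropCoord.continuous_toProj.tendsto y).comp hlim) ?_
  have hlarge : ∀ᶠ M : ℕ in Filter.atTop, ∀ (i : Fin d) (j : Fin n) (k : Fin d),
      (x.1 i).toReal - V i j - (y.1 k).toReal + V k j ≤ (M : ℝ) := by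
    simp only [Filter.eventually_all]
    exact fun i j k => tendsto_natCast_atTop_atTop.eventually_ge_atTop _
  filter_upwards [hlarge] with M hM
  refine ⟨?_, fun i j hj => ?_⟩
  · ext i
    rw [Function.comp_apply, mem_tropStratum, mem_tropStratum, hz]
    split_ifs with hi
    · exact ereal_sub_coe_eq_bot
    · exact ⟨fun h => absurd h hi, fun h => absurd (hZ h) hi⟩
  · have hyi := (mem_tropCovector_of_stratum_nonempty hyne).1 (hG i hj)
    rw [mem_tropStratum] at hyi
    rw [Function.comp_apply, mem_tropCovector]
    intro k
    have hji := mem_tropCovector.1 hj k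
    rw [hz, hz, if_pos hyi]
    by_cases hxi : x.1 i = ⊥
    · simp [hxi]
    have hxk : x.1 k ≠ ⊥ := fun h => hxi ((mem_tropCovector_of_stratum_nonempty ⟨k, h⟩).1 hj)
    rw [← x.coe_toReal hxi, ← x.coe_toReal hxk, ← EReal.coe_sub, ← EReal.coe_sub,
      EReal.coe_le_coe_iff] at hji
    rw [← x.coe_toReal hxi, ← x.coe_toReal hxk]
    split_ifs with hk
    · rw [← EReal.coe_sub, ← EReal.coe_sub, ← EReal.coe_sub, ← EReal.coe_sub,
        EReal.coe_le_coe_iff]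
      linarith
    · rw [← y.coe_toReal hk, ← EReal.coe_sub, ← EReal.coe_sub, ← EReal.coe_sub,
        EReal.coe_le_coe_iff]
      linarith [hM i j k]

theorem closure_covectorCell_subset_iff (p q : TropProj d) :
    closure (covectorCell V p) ⊆ closure (covectorCell V q) ↔
      tropStratum q ⊆ tropStratum p ∧ ∀ i, tropCovector V q i ⊆ tropCovector V p i := by
  rw [closure_covectorCell, closure_covectorCell]
  constructor
  · intro h
    exact h (show p ∈ _ from ⟨subset_rfl, fun i => subset_rfl⟩)
  · rintro ⟨h1, h2⟩ r ⟨h3, h4⟩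
    exact ⟨h1.trans h3, fun i => (h2 i).trans (h4 i)⟩

end Covector

/-! ### The homogenized dome -/

section Forms

variable {d n : ℕ} (V : Matrix (Fin d) (Fin n) ℝ)

/-- The linear forms whose nonnegativity defines the cone over the dome. -/
noncomputable def domeForm : Option (Fin n → Fin d) → ((Fin d → ℝ) × ℝ) →ₗ[ℝ] ℝ
  | none => LinearMap.snd ℝ _ _
  | some φ => ∑ j, (LinearMap.proj (φ j) ∘ₗ LinearMap.fst ℝ _ _ - V (φ j) j • LinearMap.snd ℝ _ _)

@[simp] theorem domeForm_none (u : (Fin d → ℝ) × ℝ) : domeForm V none u = u.2 := rfl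

@[simp] theorem domeForm_some (φ : Fin n → Fin d) (u : (Fin d → ℝ) × ℝ) :
    domeForm V (some φ) u = ∑ j, (u.1 (φ j) - V (φ j) j * u.2) := by
  simp [domeForm, LinearMap.sum_apply]

/-- The vector `u` in the cone over the dome satisfies with equality the inequalities
corresponding to the stratum and the covector of `x`. -/
def Corresponds (x : TropCoord d) (u : (Fin d → ℝ) × ℝ) : Prop :=
  (∀ k, 0 ≤ domeForm V k u) ∧ u ≠ 0 ∧
    (domeForm V none u = 0 ↔ (tropStratum x.toProj).Nonempty) ∧
    ∀ φ, domeForm V (some φ) u = 0 ↔ ∀ j, j ∈ tropCovector V x.toProj (φ j)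

variable {V}

theorem sum_le_sum_of_mem_tropCovector {x : TropCoord d} {u : Fin d → ℝ}
    (hx : ∀ i, x.1 i = (u i : EReal)) {φ₀ : Fin n → Fin d}
    (h₀ : ∀ j, j ∈ tropCovector V x.toProj (φ₀ j)) (φ : Fin n → Fin d) :
    ∑ j, (u (φ₀ j) - V (φ₀ j) j) ≤ ∑ j, (u (φ j) - V (φ j) j) ∧
    (∑ j, (u (φ₀ j) - V (φ₀ j) j) = ∑ j, (u (φ j) - V (φ j) j) ↔
      ∀ j, j ∈ tropCovector V x.toProj (φ j)) := by
  have hmem : ∀ i j, j ∈ tropCovector V x.toProj i ↔ ∀ k, u i - V i j ≤ u k - V k j := by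
    intro i j
    rw [mem_tropCovector]
    simp only [hx, ← EReal.coe_sub, EReal.coe_le_coe_iff]
  have hle : ∀ j ∈ Finset.univ, u (φ₀ j) - V (φ₀ j) j ≤ u (φ j) - V (φ j) j :=
    fun j _ => (hmem _ _).1 (h₀ j) _
  refine ⟨Finset.sum_le_sum hle, ?_⟩
  rw [Finset.sum_eq_sum_iff_of_le hle]
  simp only [Finset.mem_univ, true_imp_iff, hmem]
  refine forall_congr' fun j => ⟨fun h k => ?_,
    fun h => le_antisymm (hle j (Finset.mem_univ _)) (h _)⟩
  rw [← h]
  exact (hmem _ _).1 (h₀ j) k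

theorem exists_corresponds (hn : 1 ≤ n) (x : TropCoord d) : ∃ u, Corresponds V x u := by
  classical
  by_cases hZ : (tropStratum x.toProj).Nonempty
  -- A point at infinity: the indicator vector of the complement of the stratum.
  · refine ⟨(fun i => if x.1 i = ⊥ then 0 else 1, 0), ?_, ?_, ?_, ?_⟩
    · intro k
      cases k with
      | none => simp
      | some φ =>
        rw [domeForm_some]
        refine Finset.sum_nonneg fun j _ => ?_
        simp only [mul_zero, sub_zero]
        split_ifs <;> simp
    · obtain ⟨i, hi⟩ := x.2.2
      intro h
      have := congrFun (congrArg Prod.fst h) i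
      simp [hi] at this
    · simp [hZ]
    · intro φ
      simp only [domeForm_some, mul_zero, sub_zero, mem_tropCovector_of_stratum_nonempty hZ,
        mem_tropStratum]
      rw [Finset.sum_eq_zero_iff_of_nonneg fun j _ => by split_ifs <;> simp]
      simp
  · have hx : ∀ i, x.1 i = ((x.1 i).toReal : EReal) := fun i =>
      (x.coe_toReal fun h => hZ ⟨i, h⟩).symm
    set u : Fin d → ℝ := fun i => (x.1 i).toReal with hu
    choose φ₀ h₀ using exists_mem_tropCovector V x
    have hn' : (n : ℝ) ≠ 0 := by positivity
    -- The selection `φ₀` attains every minimum. Subtracting its sum divided by `n` from each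
    -- coordinate makes the least form 0, which puts the point on the boundary of the dome.
    have hform : ∀ φ, domeForm V (some φ)
        (fun i => u i - (∑ j, (u (φ₀ j) - V (φ₀ j) j)) / n, (1 : ℝ)) =
        ∑ j, (u (φ j) - V (φ j) j) - ∑ j, (u (φ₀ j) - V (φ₀ j) j) := by
      intro φ
      rw [domeForm_some]
      simp only [mul_one, sub_right_comm _ _ (V _ _)]
      rw [Finset.sum_sub_distrib]
      simp only [Finset.sum_const, Finset.card_univ, Fintype.card_fin, nsmul_eq_mul]
      rw [mul_div_cancel₀ _ hn']
    refine ⟨(fun i => u i - (∑ j, (u (φ₀ j) - V (φ₀ j) j)) / n, 1), ?_, ?_, ?_, ?_⟩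
    · intro k
      cases k with
      | none => simp
      | some φ =>
        rw [hform, sub_nonneg]
        exact (sum_le_sum_of_mem_tropCovector hx h₀ φ).1
    · intro h
      have := congrArg Prod.snd h
      simp at this
    · simp [hZ]
    · intro φ
      rw [hform, sub_eq_zero, eq_comm]
      exact (sum_le_sum_of_mem_tropCovector hx h₀ φ).2

/-- Inverse to `exists_corresponds`: divide by `t` if `t > 0`; if `t = 0`, put `-∞` exactly where
`u` vanishes. The active `φ₀` forces the least form to be 0 or the stratum to be nonempty. -/
theorem exists_corresponds_of_form_eq_zero (hn : 1 ≤ n) {u : (Fin d → ℝ) × ℝ}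
    (hu : ∀ k, 0 ≤ domeForm V k u) (hu0 : u ≠ 0) {φ₀ : Fin n → Fin d}
    (h₀ : domeForm V (some φ₀) u = 0) : ∃ x, Corresponds V x u := by
  classical
  obtain ⟨u, t⟩ := u
  have ht : 0 ≤ t := hu none
  rcases ht.eq_or_lt with rfl | ht
  · have hnn : ∀ i, 0 ≤ u i := by
      intro i
      have := hu (some fun _ => i)
      simp only [domeForm_some, mul_zero, sub_zero, Finset.sum_const, Finset.card_univ,
        Fintype.card_fin, nsmul_eq_mul] at this
      exact nonneg_of_mul_nonneg_right this (by exact_mod_cast hn)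
    have hform : ∀ φ, domeForm V (some φ) (u, 0) = 0 ↔ ∀ j, u (φ j) = 0 := by
      intro φ
      simp only [domeForm_some, mul_zero, sub_zero]
      rw [Finset.sum_eq_zero_iff_of_nonneg fun j _ => hnn _]
      simp
    have hne : ∃ i, u i ≠ 0 := by
      by_contra! hcon
      exact hu0 (Prod.ext (funext hcon) rfl)
    let x : TropCoord d := ⟨fun i => if u i = 0 then ⊥ else ((0 : ℝ) : EReal), fun i => by
      dsimp only
      split_ifs <;> simp, hne.imp fun i hi => by simp [hi]⟩
    have hx : ∀ i, i ∈ tropStratum x.toProj ↔ u i = 0 := by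
      intro i
      rw [mem_tropStratum]
      by_cases hi : u i = 0 <;> simp [x, hi]
    have hZ : (tropStratum x.toProj).Nonempty :=
      ⟨φ₀ ⟨0, hn⟩, (hx _).2 ((hform φ₀).1 h₀ _)⟩
    refine ⟨x, hu, hu0, by simp [hZ], fun φ => ?_⟩
    rw [hform]
    simp only [mem_tropCovector_of_stratum_nonempty hZ, hx]
  · have hd : ∃ i : Fin d, True := ⟨φ₀ ⟨0, hn⟩, trivial⟩
    obtain ⟨i₀, -⟩ := hd
    let x : TropCoord d := ⟨fun i => ((u i / t : ℝ) : EReal),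
      fun i => EReal.coe_ne_top _, i₀, EReal.coe_ne_bot _⟩
    have hx : ∀ i, x.1 i = ((u i / t : ℝ) : EReal) := fun _ => rfl
    choose φ₁ h₁ using exists_mem_tropCovector V x
    have hform : ∀ φ, domeForm V (some φ) (u, t) = t * ∑ j, (u (φ j) / t - V (φ j) j) := by
      intro φ
      rw [domeForm_some, Finset.mul_sum]
      refine Finset.sum_congr rfl fun j _ => ?_
      field_simp
    have hsum : ∑ j, (u (φ₁ j) / t - V (φ₁ j) j) = 0 := by
      refine le_antisymm ?_ ?_
      · rw [hform, mul_eq_zero] at h₀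
        rw [← h₀.resolve_left ht.ne']
        exact (sum_le_sum_of_mem_tropCovector hx h₁ φ₀).1
      · have := hu (some φ₁)
        rw [hform] at this
        exact nonneg_of_mul_nonneg_right this ht
    refine ⟨x, hu, hu0, ?_, fun φ => ?_⟩
    · rw [domeForm_none]
      refine ⟨fun h => absurd h ht.ne', ?_⟩
      rintro ⟨i, hi⟩
      exact absurd hi (EReal.coe_ne_bot _)
    · rw [hform, mul_eq_zero, or_iff_right ht.ne', ← hsum, eq_comm]
      exact (sum_le_sum_of_mem_tropCovector hx h₁ φ).2

theorem Corresponds.forall_iff (hn : 1 ≤ n) {x x' : TropCoord d} {u u' : (Fin d → ℝ) × ℝ}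
    (h : Corresponds V x u) (h' : Corresponds V x' u') :
    (∀ k, domeForm V k u = 0 → domeForm V k u' = 0) ↔
      tropStratum x.toProj ⊆ tropStratum x'.toProj ∧
        ∀ i, tropCovector V x.toProj i ⊆ tropCovector V x'.toProj i := by
  constructor
  · intro hk
    have hG : ∀ i, tropCovector V x.toProj i ⊆ tropCovector V x'.toProj i := by
      intro i j hj
      choose φ₀ h₀ using exists_mem_tropCovector V x
      -- A single incidence `j ∈ G_i` is detected by a selection of minimisers rerouted through `i`
      -- at `j`.
      have h1 := (h.2.2.2 (Function.update φ₀ j i)).2 fun j' => by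
        by_cases he : j' = j
        · subst he; rwa [Function.update_self]
        · rw [Function.update_of_ne he]; exact h₀ j'
      have h2 := (h'.2.2.2 _).1 (hk _ h1) j
      rwa [Function.update_self] at h2
    refine ⟨fun i hi => ?_, hG⟩
    have h1 := h'.2.2.1.1 (hk none (h.2.2.1.2 ⟨i, hi⟩))
    -- On nonempty strata any one column recovers the stratum from the covector; `n ≥ 1` supplies
    -- one.
    rw [← mem_tropCovector_of_stratum_nonempty (V := V) (j := ⟨0, hn⟩) h1]
    exact hG i ((mem_tropCovector_of_stratum_nonempty ⟨i, hi⟩).2 hi)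
  · rintro ⟨hZ, hG⟩ k hk
    cases k with
    | none => exact h'.2.2.1.2 ((h.2.2.1.1 hk).mono hZ)
    | some φ => exact (h'.2.2.2 φ).2 fun j => hG _ ((h.2.2.2 φ).1 hk j)

theorem Corresponds.exists_some {x : TropCoord d} {u : (Fin d → ℝ) × ℝ}
    (h : Corresponds V x u) : ∃ φ, domeForm V (some φ) u = 0 := by
  choose φ₀ h₀ using exists_mem_tropCovector V x
  exact ⟨φ₀, (h.2.2.2 φ₀).2 h₀⟩

end Forms

/-! ### Existence of points beyond the base facet. -/

theorem exists_isBeyond_baseFace {Φ : Type*} [Finite Φ] {d : ℕ}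
    {b : Option Φ → (Fin d → ℝ) →ᵃ[ℝ] ℝ} {q z : Fin d → ℝ} (hq : ∀ k, 0 < b k q)
    (hz : b none z = 0) (hz' : ∀ φ, 0 < b (some φ) z) :
    ∃ y, IsBeyond (polyhedron b) (baseFace b) y := by
  obtain ⟨ε, hε, hmem⟩ := exists_lineMap_neg_mem_polyhedron (b := fun φ => b (some φ)) (g := z)
    (x := q) (fun φ => (hz' φ).le) fun φ h => absurd h (hz' φ).ne'
  -- Halving the step gives the midpoint of `z`, where the inequalities are strict, and a point
  -- where they hold weakly.
  refine ⟨AffineMap.lineMap z q (-(ε / 2)), isBeyond_baseFace hq ?_ fun φ => ?_⟩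
  · rw [affineMap_lineMap, hz]
    nlinarith [mul_pos hε (hq none)]
  · have h := hmem φ
    rw [affineMap_lineMap] at h ⊢
    nlinarith [hz' φ]

/-! ### Changing the model of the ambient space -/

section Transport

variable {W W' : Type*} [AddCommGroup W] [Module ℝ W] [AddCommGroup W'] [Module ℝ W'] {d : ℕ}

/-- The linear isomorphism `T`, read on an isomorphic copy of its domain. -/
def transportEquiv (e : W ≃ₗ[ℝ] W') (T : (W × ℝ) ≃ₗ[ℝ] ((Fin d → ℝ) × ℝ)) :
    (W' × ℝ) ≃ₗ[ℝ] ((Fin d → ℝ) × ℝ) :=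
  (e.symm.prodCongr (LinearEquiv.refl ℝ ℝ)).trans T

@[simp] theorem transportEquiv_apply (e : W ≃ₗ[ℝ] W')
    (T : (W × ℝ) ≃ₗ[ℝ] ((Fin d → ℝ) × ℝ)) (w : W) (t : ℝ) :
    transportEquiv e T (e w, t) = T (w, t) := by
  simp [transportEquiv]

theorem image_transportEquiv (e : W ≃ₗ[ℝ] W') (T : (W × ℝ) ≃ₗ[ℝ] ((Fin d → ℝ) × ℝ))
    (P : Set W) (t : ℝ) :
    (fun p => dehomogenize (transportEquiv e T (p, t))) '' (e '' P) =
      (fun p => dehomogenize (T (p, t))) '' P := by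
  rw [Set.image_image]
  simp

theorem isBoundedProjective_transport (e : W ≃ₗ[ℝ] W')
    (T : (W × ℝ) ≃ₗ[ℝ] ((Fin d → ℝ) × ℝ)) (P : Set W) :
    IsBoundedProjective (transportEquiv e T) (e '' P) ↔ IsBoundedProjective T P := by
  unfold IsBoundedProjective
  rw [image_transportEquiv, Set.forall_mem_image]
  simp

theorem projectiveModel_transport (e : W ≃ₗ[ℝ] W')
    (T : (W × ℝ) ≃ₗ[ℝ] ((Fin d → ℝ) × ℝ)) (P : Set W) :
    projectiveModel (transportEquiv e T) (e '' P) = projectiveModel T P := by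
  unfold projectiveModel
  rw [image_transportEquiv]

theorem recCone_image (e : W ≃ₗ[ℝ] W') (P : Set W) : recCone (e '' P) = e '' recCone P := by
  ext v
  obtain ⟨v, rfl⟩ := e.surjective v
  rw [e.injective.mem_set_image]
  simp only [recCone, Set.mem_ofPred_eq, Set.forall_mem_image, ← map_smul, ← map_add,
    e.injective.mem_set_image]

theorem faceAtInfinity_transport (e : W ≃ₗ[ℝ] W')
    (T : (W × ℝ) ≃ₗ[ℝ] ((Fin d → ℝ) × ℝ)) (P : Set W) :
    faceAtInfinity (transportEquiv e T) (e '' P) = faceAtInfinity T P := by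
  unfold faceAtInfinity
  rw [← image_transportEquiv e T, recCone_image, Set.image_sdiff e.injective,
    Set.image_singleton, map_zero]

end Transport

/-! ### The dome as a polyhedron -/

section Dome

variable {d n : ℕ} (V : Matrix (Fin d) (Fin n) ℝ)

/-- The projection along `(𝟏, n)` onto the slice `s = 0`. -/
noncomputable def sliceMap (d n : ℕ) : ((Fin d → ℝ) × ℝ) →ₗ[ℝ] (Fin d → ℝ) :=
  LinearMap.fst ℝ _ _ - (LinearMap.toSpanSingleton ℝ (Fin d → ℝ) fun _ => (n : ℝ)⁻¹) ∘ₗ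
    LinearMap.snd ℝ _ _

@[simp] theorem sliceMap_apply (z : (Fin d → ℝ) × ℝ) (i : Fin d) :
    sliceMap d n z i = z.1 i - z.2 * (n : ℝ)⁻¹ := by
  simp [sliceMap]

theorem sliceMap_surjective : Function.Surjective (sliceMap d n) := fun u =>
  ⟨(u, 0), by ext i; simp⟩

theorem span_eq_ker_sliceMap (hn : 1 ≤ n) :
    Submodule.span ℝ {((fun _ => 1, (n : ℝ)) : (Fin d → ℝ) × ℝ)} =
      LinearMap.ker (sliceMap d n) := by
  have hn' : (n : ℝ) ≠ 0 := by positivity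
  ext z
  rw [Submodule.mem_span_singleton, LinearMap.mem_ker]
  constructor
  · rintro ⟨a, rfl⟩
    ext i
    simp [hn']
  · intro h
    refine ⟨z.2 * (n : ℝ)⁻¹, Prod.ext (funext fun i => ?_) ?_⟩
    · have := congrFun h i
      simp only [sliceMap_apply, Pi.zero_apply] at this
      simp only [Prod.smul_fst, Pi.smul_apply, smul_eq_mul, mul_one]
      linarith
    · simp [hn']

/-- Coordinates on the space in which the dome lives. -/
noncomputable def sliceEquiv (d : ℕ) {n : ℕ} (hn : 1 ≤ n) : DomeSpace d n ≃ₗ[ℝ] (Fin d → ℝ) :=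
  (Submodule.quotEquivOfEq _ _ (span_eq_ker_sliceMap hn)).trans
    ((sliceMap d n).quotKerEquivOfSurjective sliceMap_surjective)

/-- The dome in the slice `s = 0`. -/
def domeModel : Set (Fin d → ℝ) := {u | ∀ φ, 0 ≤ domeForm V (some φ) (u, 1)}

theorem le_tropProductForm_iff (hd : 1 ≤ d) (x : Fin d → ℝ) (s : ℝ) :
    s ≤ tropProductForm V x ↔ ∀ φ : Fin n → Fin d, s ≤ ∑ j, (x (φ j) - V (φ j) j) := by
  have : Nonempty (Fin d) := ⟨⟨0, hd⟩⟩
  constructor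
  · intro h φ
    exact h.trans (Finset.sum_le_sum fun j _ => ciInf_le (Set.finite_range _).bddBelow (φ j))
  · intro h
    choose φ hφ using fun j => exists_eq_ciInf_of_finite (f := fun i => x i - V i j)
    unfold tropProductForm
    simp only [← hφ]
    exact h φ

theorem sliceEquiv_image_dome (hd : 1 ≤ d) (hn : 1 ≤ n) :
    sliceEquiv d hn '' dome V = domeModel V := by
  have hn' : (n : ℝ) ≠ 0 := by positivity
  have key : ∀ z : (Fin d → ℝ) × ℝ, z.2 ≤ tropProductForm V z.1 ↔
      sliceMap d n z ∈ domeModel V := by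
    intro z
    rw [le_tropProductForm_iff V hd]
    refine forall_congr' fun φ => ?_
    rw [domeForm_some, ← sub_nonneg]
    have : ∑ j, (sliceMap d n z (φ j) - V (φ j) j * 1) =
        ∑ j, (z.1 (φ j) - V (φ j) j) - z.2 := by
      simp only [sliceMap_apply, mul_one, sub_right_comm _ _ (V _ _)]
      rw [Finset.sum_sub_distrib]
      simp only [Finset.sum_const, Finset.card_univ, Fintype.card_fin, nsmul_eq_mul]
      field_simp
    rw [this]
  unfold dome
  rw [Set.image_image]
  ext u
  constructor
  · rintro ⟨z, hz, rfl⟩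
    exact (key z).1 hz
  · intro hu
    obtain ⟨z, rfl⟩ := sliceMap_surjective (n := n) u
    exact ⟨z, (key z).2 hu, rfl⟩

theorem exists_domeForm_pos (hn : 1 ≤ n) :
    ∃ p : Fin d → ℝ, ∀ φ, 0 < domeForm V (some φ) (p, 1) := by
  have : Nonempty (Fin n) := ⟨⟨0, hn⟩⟩
  refine ⟨fun _ => 1 + ∑ k, ∑ j, |V k j|, fun φ => ?_⟩
  rw [domeForm_some]
  refine Finset.sum_pos (fun j _ => ?_) Finset.univ_nonempty
  have h2 : ∑ j', |V (φ j) j'| ≤ ∑ k, ∑ j, |V k j| :=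
    Finset.single_le_sum (f := fun k => ∑ j, |V k j|)
      (fun _ _ => Finset.sum_nonneg fun _ _ => abs_nonneg _) (Finset.mem_univ (φ j))
  have h3 : |V (φ j) j| ≤ ∑ j', |V (φ j) j'| :=
    Finset.single_le_sum (f := fun j' => |V (φ j) j'|) (fun _ _ => abs_nonneg _)
      (Finset.mem_univ j)
  have h4 := le_abs_self (V (φ j) j)
  dsimp only
  linarith

theorem domeForm_const (i : Fin d) (u : (Fin d → ℝ) × ℝ) :
    domeForm V (some fun _ => i) u = n * u.1 i - (∑ j, V i j) * u.2 := by
  rw [domeForm_some, Finset.sum_sub_distrib, Finset.sum_mul]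
  simp

theorem domeForm_line (φ : Fin n → Fin d) (p v : Fin d → ℝ) (r : ℝ) :
    domeForm V (some φ) (p + r • v, 1) =
      domeForm V (some φ) (p, 1) + r * domeForm V (some φ) (v, 0) := by
  rw [← smul_eq_mul, ← map_smul, ← map_add]
  simp

theorem recCone_domeModel (hn : 1 ≤ n) :
    recCone (domeModel V) = {v | ∀ φ, 0 ≤ domeForm V (some φ) (v, 0)} := by
  ext v
  constructor
  · intro hv φ
    obtain ⟨p, hp⟩ := exists_domeForm_pos V hn
    by_contra! hneg
    set A := domeForm V (some φ) (p, 1) with hA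
    set B := domeForm V (some φ) (v, 0) with hB
    have hpA : 0 < A := hp φ
    -- At this parameter the form takes the value -1.
    have h := hv p (fun φ => (hp φ).le) ((A + 1) / (-B))
      (div_nonneg (by linarith) (by linarith)) φ
    rw [domeForm_line, ← hA, ← hB] at h
    have hB' : -B ≠ 0 := by linarith
    have : (A + 1) / (-B) * B = -(A + 1) := by
      have hB2 : B ≠ 0 := hneg.ne
      field_simp
    linarith
  · intro hv p hp t ht φ
    rw [domeForm_line]
    exact add_nonneg (hp φ) (mul_nonneg ht (hv φ))

/-- Constant selections bound each `u i` below by the row mean `m i`. The new denominator `∑ i, u i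
+ c` is then at least 1 on the dome and controls every `|u i|`. -/
theorem exists_isBoundedProjective (hn : 1 ≤ n) :
    ∃ S : ((Fin d → ℝ) × ℝ) ≃ₗ[ℝ] ((Fin d → ℝ) × ℝ), IsBoundedProjective S (domeModel V) := by
  have hn0 : (0 : ℝ) < n := by exact_mod_cast hn
  set m : Fin d → ℝ := fun i => (∑ j, V i j) / n with hm
  set c : ℝ := 1 + ∑ i, |m i| with hc
  have hc0 : 0 < c := by
    have : 0 ≤ ∑ i, |m i| := Finset.sum_nonneg fun _ _ => abs_nonneg _
    linarith
  let S : ((Fin d → ℝ) × ℝ) ≃ₗ[ℝ] ((Fin d → ℝ) × ℝ) :=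
    { toFun := fun z => (z.1, ∑ i, z.1 i + c * z.2)
      invFun := fun z => (z.1, c⁻¹ * (z.2 - ∑ i, z.1 i))
      map_add' := fun z w => by
        refine Prod.ext rfl ?_
        simp only [Prod.fst_add, Prod.snd_add, Pi.add_apply, Finset.sum_add_distrib]
        ring
      map_smul' := fun a z => by
        refine Prod.ext rfl ?_
        simp only [Prod.smul_fst, Prod.smul_snd, Pi.smul_apply, smul_eq_mul, RingHom.id_apply,
          ← Finset.mul_sum]
        ring
      left_inv := fun z => by
        refine Prod.ext rfl ?_
        simp only [add_sub_cancel_left]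
        field_simp
      right_inv := fun z => by
        refine Prod.ext rfl ?_
        simp only
        field_simp
        ring }
  have hS : ∀ z, S z = (z.1, ∑ i, z.1 i + c * z.2) := fun _ => rfl
  have hlow : ∀ u ∈ domeModel V, ∀ i, -|m i| ≤ u i := by
    intro u hu i
    have h := hu fun _ => i
    rw [domeForm_const] at h
    have : m i ≤ u i := by
      rw [hm]
      simp only
      rw [div_le_iff₀ hn0]
      linarith
    linarith [neg_abs_le (m i)]
  have hs : ∀ u ∈ domeModel V, 1 ≤ ∑ i, u i + c := by
    intro u hu
    have := Finset.sum_le_sum fun i (_ : i ∈ Finset.univ) => hlow u hu i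
    rw [Finset.sum_neg_distrib] at this
    linarith
  refine ⟨S, fun u hu => ?_, ?_⟩
  · rw [hS]
    have := hs u hu
    simp only [mul_one]
    linarith
  · rw [isBounded_iff_forall_norm_le]
    refine ⟨c, ?_⟩
    rintro _ ⟨u, hu, rfl⟩
    have h1 := hs u hu
    simp only [hS, mul_one, dehomogenize]
    set s := ∑ i, u i + c with hs'
    rw [pi_norm_le_iff_of_nonneg hc0.le]
    intro i
    rw [Pi.smul_apply, smul_eq_mul, Real.norm_eq_abs, abs_mul, abs_inv,
      abs_of_pos (by linarith : 0 < s),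
      inv_mul_le_iff₀ (by linarith)]
    have hmi : |m i| ≤ ∑ i, |m i| :=
      Finset.single_le_sum (f := fun i => |m i|) (fun _ _ => abs_nonneg _) (Finset.mem_univ i)
    have h2 : u i + |m i| ≤ ∑ i, (u i + |m i|) :=
      Finset.single_le_sum (f := fun i => u i + |m i|)
        (fun k _ => by linarith [hlow u hu k]) (Finset.mem_univ i)
    rw [Finset.sum_add_distrib] at h2
    have h3 := hlow u hu i
    have h4 := abs_nonneg (m i)
    have hc1 : 1 ≤ c := by linarith
    rw [abs_le]
    constructor <;> nlinarith

end Dome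

/-! ### The bounded model of the dome -/

/-- Both posets are indexed by the same, possibly redundant, family; antisymmetry of inclusion takes
care of repetitions. -/
theorem nonempty_orderIso_of_range {ι α β : Type*} {A : Set (Set α)} {B : Set (Set β)}
    (f : ι → Set α) (g : ι → Set β) (hA : A = Set.range f) (hB : B = Set.range g)
    (h : ∀ i j, f i ⊆ f j ↔ g i ⊆ g j) : Nonempty (A ≃o B) := by
  subst hA hB
  choose s hs using fun a : Set.range f => a.2
  let e : Set.range f ↪o Set.range g :=
    OrderEmbedding.ofMapLEIff (fun a => ⟨g (s a), s a, rfl⟩) fun a b => by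
      change g (s a) ⊆ g (s b) ↔ (a : Set α) ⊆ b
      rw [← h, hs, hs]
  refine ⟨RelIso.ofSurjective e ?_⟩
  rintro ⟨_, i, rfl⟩
  refine ⟨⟨f i, i, rfl⟩, Subtype.ext ?_⟩
  have h1 : f (s ⟨f i, i, rfl⟩) = f i := hs ⟨f i, i, rfl⟩
  exact Set.Subset.antisymm ((h _ _).1 h1.le) ((h _ _).1 h1.ge)

section Model

variable {d n : ℕ} {V : Matrix (Fin d) (Fin n) ℝ} {S : ((Fin d → ℝ) × ℝ) ≃ₗ[ℝ] ((Fin d → ℝ) × ℝ)}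

/-- The forms defining the cone over the dome, in the affine chart given by `S`. -/
noncomputable def chartForm (V : Matrix (Fin d) (Fin n) ℝ)
    (S : ((Fin d → ℝ) × ℝ) ≃ₗ[ℝ] ((Fin d → ℝ) × ℝ)) (k : Option (Fin n → Fin d)) :
    (Fin d → ℝ) →ᵃ[ℝ] ℝ :=
  (domeForm V k ∘ₗ S.symm.toLinearMap).toAffineMap.comp
    ((AffineMap.id ℝ (Fin d → ℝ)).prod (AffineMap.const ℝ (Fin d → ℝ) (1 : ℝ)))

theorem chartForm_apply (k : Option (Fin n → Fin d)) (y : Fin d → ℝ) :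
    chartForm V S k y = domeForm V k (S.symm (y, 1)) := rfl

theorem prodMk_dehomogenize {u : (Fin d → ℝ) × ℝ} (hu : (S u).2 ≠ 0) :
    ((dehomogenize (S u), 1) : (Fin d → ℝ) × ℝ) = S ((S u).2⁻¹ • u) := by
  rw [map_smul]
  refine Prod.ext rfl ?_
  simp [hu]

theorem chartForm_dehomogenize (k : Option (Fin n → Fin d)) {u : (Fin d → ℝ) × ℝ}
    (hu : (S u).2 ≠ 0) :
    chartForm V S k (dehomogenize (S u)) = (S u).2⁻¹ * domeForm V k u := by
  rw [chartForm_apply, prodMk_dehomogenize hu, S.symm_apply_apply, map_smul, smul_eq_mul]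

theorem dehomogenize_smul_symm {t : ℝ} (ht : t ≠ 0) (y : Fin d → ℝ) :
    dehomogenize (S (t • S.symm (y, 1))) = y := by
  rw [map_smul, S.apply_symm_apply]
  simp [dehomogenize, ht]

theorem symm_mk_one_ne_zero (y : Fin d → ℝ) : S.symm (y, 1) ≠ 0 := by
  intro h
  rw [LinearEquiv.map_eq_zero_iff] at h
  simpa using congrArg Prod.snd h

theorem smul_eq_mk_one {u : (Fin d → ℝ) × ℝ} (hu : u.2 ≠ 0) :
    u.2⁻¹ • u = (u.2⁻¹ • u.1, 1) := Prod.ext rfl (by simp [hu])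

/-- Positivity at finite points is part of admissibility. For a recession direction it follows from
boundedness: with denominator constant along a ray of the dome, the image would be an unbounded ray.
-/
theorem snd_pos_of_forms_nonneg (hn : 1 ≤ n) (hS : IsBoundedProjective S (domeModel V))
    {u : (Fin d → ℝ) × ℝ} (hu : ∀ k, 0 ≤ domeForm V k u) (hu0 : u ≠ 0) : 0 < (S u).2 := by
  have ht : 0 ≤ u.2 := hu none
  rcases ht.eq_or_lt with ht | ht
  · obtain ⟨v, t⟩ := u
    simp only at ht
    subst ht
    obtain ⟨p, hp⟩ := exists_domeForm_pos V hn
    have hmem : ∀ r : ℝ, 0 ≤ r → p + r • v ∈ domeModel V := fun r hr φ => by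
      rw [domeForm_line]
      exact add_nonneg (hp φ).le (mul_nonneg hr (hu _))
    have hline : ∀ r : ℝ, S (p + r • v, 1) = S (p, 1) + r • S (v, 0) := fun r => by
      rw [← map_smul, ← map_add]
      simp
    have hpos : ∀ r : ℝ, 0 ≤ r → 0 < (S (p, 1)).2 + r * (S (v, 0)).2 := fun r hr => by
      have := hS.1 _ (hmem r hr)
      rw [hline] at this
      simpa using this
    have hA : 0 < (S (p, 1)).2 := by simpa using hpos 0 le_rfl
    have hB : 0 ≤ (S (v, 0)).2 := by
      by_contra! hneg
      have := hpos ((S (p, 1)).2 / -(S (v, 0)).2) (div_nonneg hA.le (by linarith))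
      rw [div_mul_eq_mul_div, div_neg, mul_div_cancel_right₀ _ hneg.ne] at this
      linarith
    refine lt_of_le_of_ne hB fun hB0 => ?_
    have hw : (S (v, 0)).1 ≠ 0 := by
      intro h
      exact hu0 (S.map_eq_zero_iff.1 (Prod.ext h hB0.symm))
    obtain ⟨C, hC⟩ := isBounded_iff_forall_norm_le.1 hS.2
    set w := (S (p, 1)).2⁻¹ • (S (v, 0)).1 with hw'
    have hwpos : 0 < ‖w‖ := norm_pos_iff.2 (smul_ne_zero (inv_ne_zero hA.ne') hw)
    have hC' : ∀ r : ℝ, 0 ≤ r → ‖(S (p, 1)).2⁻¹ • (S (p, 1)).1 + r • w‖ ≤ C := fun r hr => by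
      have := hC _ ⟨_, hmem r hr, rfl⟩
      simp only [dehomogenize, hline, Prod.snd_add, Prod.smul_snd, ← hB0, smul_zero, add_zero,
        Prod.fst_add, Prod.smul_fst, smul_add] at this
      rwa [smul_comm] at this
    have h0 := hC' 0 le_rfl
    have hC0 : 0 ≤ C := (norm_nonneg _).trans h0
    -- This parameter moves the image by `2 * C + 1`, too far for two points of norm at most `C`.
    have hr : 0 ≤ (2 * C + 1) / ‖w‖ := by positivity
    have h1 := hC' _ hr
    have h2 := norm_sub_le ((S (p, 1)).2⁻¹ • (S (p, 1)).1 + ((2 * C + 1) / ‖w‖) • w)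
      ((S (p, 1)).2⁻¹ • (S (p, 1)).1 + (0 : ℝ) • w)
    rw [zero_smul, add_zero] at h0 h2
    rw [add_sub_cancel_left, norm_smul, Real.norm_of_nonneg hr, div_mul_cancel₀ _ hwpos.ne'] at h2
    linarith
  · have h := hS.1 (u.2⁻¹ • u.1) fun φ => by
      rw [← smul_eq_mk_one ht.ne', map_smul]
      exact mul_nonneg (inv_nonneg.2 ht.le) (hu _)
    rw [← smul_eq_mk_one ht.ne', map_smul] at h
    exact pos_of_mul_pos_right h (inv_nonneg.2 ht.le)

theorem dehomogenize_mem_polyhedron (hn : 1 ≤ n) (hS : IsBoundedProjective S (domeModel V))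
    {u : (Fin d → ℝ) × ℝ} (hu : ∀ k, 0 ≤ domeForm V k u) (hu0 : u ≠ 0) :
    dehomogenize (S u) ∈ polyhedron (chartForm V S) := fun k => by
  have h := snd_pos_of_forms_nonneg hn hS hu hu0
  rw [chartForm_dehomogenize k h.ne']
  exact mul_nonneg (inv_nonneg.2 h.le) (hu k)

theorem mk_one_ne_zero (p : Fin d → ℝ) : ((p, 1) : (Fin d → ℝ) × ℝ) ≠ 0 := fun h => by
  simpa using congrArg Prod.snd h

theorem domeForm_mk_one_nonneg {p : Fin d → ℝ} (hp : p ∈ domeModel V)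
    (k : Option (Fin n → Fin d)) : 0 ≤ domeForm V k (p, 1) := by
  cases k with
  | none => simp
  | some φ => exact hp φ

theorem exists_interior (hn : 1 ≤ n) (hS : IsBoundedProjective S (domeModel V)) :
    ∃ q, ∀ k, 0 < chartForm V S k q := by
  obtain ⟨p, hp⟩ := exists_domeForm_pos V hn
  have hp' : p ∈ domeModel V := fun φ => (hp φ).le
  have h := hS.1 p hp'
  refine ⟨dehomogenize (S (p, 1)), fun k => ?_⟩
  rw [chartForm_dehomogenize k h.ne']
  refine mul_pos (inv_pos.2 h) ?_
  cases k with
  | none => simp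
  | some φ => exact hp φ

theorem exists_interior_baseFace (hd : 1 ≤ d) (hn : 1 ≤ n)
    (hS : IsBoundedProjective S (domeModel V)) :
    ∃ z, chartForm V S none z = 0 ∧ ∀ φ, 0 < chartForm V S (some φ) z := by
  -- Every form takes the value `n` on the all-ones direction at infinity.
  have hpos : ∀ φ, 0 < domeForm V (some φ) ((fun _ => 1, 0) : (Fin d → ℝ) × ℝ) := fun φ => by
    rw [domeForm_some]
    simpa using Nat.lt_of_lt_of_le Nat.zero_lt_one hn
  have h := snd_pos_of_forms_nonneg hn hS (u := (fun _ => 1, 0)) (fun k => by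
    cases k with
    | none => simp
    | some φ => exact (hpos φ).le) (fun h => by
      have := congrFun (congrArg Prod.fst h) ⟨0, hd⟩
      simp at this)
  refine ⟨dehomogenize (S (fun _ => 1, 0)), ?_, fun φ => ?_⟩
  · rw [chartForm_dehomogenize none h.ne']
    simp
  · rw [chartForm_dehomogenize _ h.ne']
    exact mul_pos (inv_pos.2 h) (hpos φ)

theorem projectiveModel_eq_polyhedron (hn : 1 ≤ n) (hS : IsBoundedProjective S (domeModel V)) :
    projectiveModel S (domeModel V) = polyhedron (chartForm V S) := by
  refine Set.Subset.antisymm (closure_minimal ?_ isClosed_polyhedron) fun y hy => ?_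
  · rintro _ ⟨p, hp, rfl⟩
    exact dehomogenize_mem_polyhedron hn hS (domeForm_mk_one_nonneg hp) (mk_one_ne_zero p)
  · have himage : ∀ y ∈ polyhedron (chartForm V S), 0 < chartForm V S none y →
        y ∈ (fun p => dehomogenize (S (p, 1))) '' domeModel V := by
      intro y hy h0
      rw [chartForm_apply, domeForm_none] at h0
      refine ⟨(S.symm (y, 1)).2⁻¹ • (S.symm (y, 1)).1, fun φ => ?_, ?_⟩
      · rw [← smul_eq_mk_one h0.ne', map_smul]
        exact mul_nonneg (inv_nonneg.2 h0.le) (hy (some φ))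
      · simp only
        rw [← smul_eq_mk_one h0.ne', dehomogenize_smul_symm (inv_ne_zero h0.ne')]
    -- Points at infinity are limits along segments towards an interior point, whose other points
    -- are images of dome points.
    obtain ⟨q, hq⟩ := exists_interior hn hS
    have hlim : Filter.Tendsto (fun ε : ℝ => (AffineMap.lineMap y q ε : Fin d → ℝ))
        (nhdsWithin 0 (Set.Ioi 0)) (nhds y) := by
      have hc : Continuous fun ε : ℝ => (AffineMap.lineMap y q ε : Fin d → ℝ) :=
        AffineMap.lineMap_continuous
      have := hc.tendsto 0
      rw [AffineMap.lineMap_apply_zero] at this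
      exact this.mono_left nhdsWithin_le_nhds
    refine mem_closure_of_tendsto hlim ?_
    filter_upwards [Ioo_mem_nhdsGT (show (0 : ℝ) < 1 by norm_num)] with ε hε
    refine himage _ (lineMap_mem_polyhedron hy (fun k => (hq k).le) hε.1.le hε.2.le) ?_
    rw [affineMap_lineMap]
    exact add_pos_of_nonneg_of_pos (mul_nonneg (by linarith [hε.2]) (hy none))
      (mul_pos hε.1 (hq none))

theorem faceAtInfinity_eq_baseFace (hn : 1 ≤ n) (hS : IsBoundedProjective S (domeModel V)) :
    faceAtInfinity S (domeModel V) = baseFace (chartForm V S) := by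
  unfold faceAtInfinity
  rw [recCone_domeModel V hn]
  refine Set.Subset.antisymm ?_ ?_
  · rintro _ ⟨v, ⟨hv, hv0⟩, rfl⟩
    have hforms : ∀ k, 0 ≤ domeForm V k (v, 0) := fun k => by
      cases k with
      | none => simp
      | some φ => exact hv φ
    have hne : ((v, 0) : (Fin d → ℝ) × ℝ) ≠ 0 := fun h => hv0 (congrArg Prod.fst h)
    refine ⟨dehomogenize_mem_polyhedron hn hS hforms hne, ?_⟩
    rw [chartForm_dehomogenize _ (snd_pos_of_forms_nonneg hn hS hforms hne).ne']
    simp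
  · rintro y ⟨hy, hy0⟩
    rw [chartForm_apply, domeForm_none] at hy0
    have hsymm : S.symm (y, 1) = ((S.symm (y, 1)).1, 0) := Prod.ext rfl hy0
    refine ⟨(S.symm (y, 1)).1, ⟨fun φ => ?_, fun h => ?_⟩, ?_⟩
    · rw [← hsymm]
      exact hy (some φ)
    · exact symm_mk_one_ne_zero (S := S) y (Prod.ext h hy0)
    · simp only
      rw [← hsymm]
      have := dehomogenize_smul_symm (S := S) one_ne_zero y
      rwa [one_smul] at this

theorem isSimplex_baseFace (hn : 1 ≤ n) (hS : IsBoundedProjective S (domeModel V)) :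
    IsSimplex d (baseFace (chartForm V S)) := by
  classical
  let e : Fin d → (Fin d → ℝ) × ℝ := fun i => (Pi.single i 1, 0)
  have hforms : ∀ i k, 0 ≤ domeForm V k (e i) := fun i k => by
    cases k with
    | none => simp [e]
    | some φ =>
      rw [domeForm_some]
      refine Finset.sum_nonneg fun j _ => ?_
      simp only [e, mul_zero, sub_zero, Pi.single_apply]
      split_ifs <;> simp
  have hne : ∀ i, e i ≠ 0 := fun i h => by
    have := congrFun (congrArg Prod.fst h) i
    simp [e] at this
  have hpos : ∀ i, 0 < (S (e i)).2 := fun i => snd_pos_of_forms_nonneg hn hS (hforms i) (hne i)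
  -- Affine combinations of the vertices lift to linear combinations of the unit vectors `e i`, with
  -- weights rescaled by the positive denominators. Affine independence and the hull description
  -- thus reduce to facts about the orthant.
  have hcomb : ∀ (s : Finset (Fin d)) (w : Fin d → ℝ),
      ((∑ i ∈ s, w i • dehomogenize (S (e i)), ∑ i ∈ s, w i) : (Fin d → ℝ) × ℝ) =
        S (∑ i ∈ s, (w i * (S (e i)).2⁻¹) • e i) := by
    intro s w
    have : ∀ i, S ((w i * (S (e i)).2⁻¹) • e i) = w i • (dehomogenize (S (e i)), (1 : ℝ)) := by
      intro i
      rw [prodMk_dehomogenize (hpos i).ne', mul_smul, map_smul]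
    simp only [map_sum, this]
    refine Prod.ext ?_ ?_
    · simp [Prod.fst_sum]
    · simp [Prod.snd_sum]
  have hcoord : ∀ (s : Finset (Fin d)) (c : Fin d → ℝ) (i : Fin d),
      (∑ k ∈ s, c k • e k).1 i = if i ∈ s then c i else 0 := by
    intro s c i
    simp [Prod.fst_sum, Finset.sum_apply, e, Pi.single_apply]
  refine ⟨fun i => dehomogenize (S (e i)), ?_, Set.Subset.antisymm ?_ ?_⟩
  · rw [affineIndependent_iff]
    intro s w hw hsum i hi
    have h := hcomb s w
    rw [hw, hsum] at h
    have h0 := S.map_eq_zero_iff.1 h.symm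
    have h1 := hcoord s (fun i => w i * (S (e i)).2⁻¹) i
    rw [h0, if_pos hi] at h1
    exact (mul_eq_zero.1 h1.symm).resolve_right (inv_ne_zero (hpos i).ne')
  · rintro y ⟨hy, hy0⟩
    rw [chartForm_apply, domeForm_none] at hy0
    set v := S.symm (y, 1) with hv
    have hvnn : ∀ i, 0 ≤ v.1 i := by
      intro i
      have h := hy (some fun _ => i)
      rw [chartForm_apply, domeForm_const, ← hv, hy0, mul_zero, sub_zero] at h
      exact nonneg_of_mul_nonneg_right h (by exact_mod_cast hn)
    have hvsum : v = ∑ i, ((v.1 i * (S (e i)).2) * (S (e i)).2⁻¹) • e i := by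
      refine Prod.ext (funext fun i => ?_) ?_
      · rw [hcoord, if_pos (Finset.mem_univ _), mul_inv_cancel_right₀ (hpos i).ne']
      · rw [hy0]
        simp [Prod.snd_sum, e]
    have hySv : (y, 1) = S v := by rw [hv, S.apply_symm_apply]
    rw [hvsum, ← hcomb] at hySv
    have h1 := congrArg Prod.fst hySv
    have h2 := congrArg Prod.snd hySv
    simp only at h1 h2
    rw [h1]
    exact (convex_convexHull ℝ _).sum_mem
      (fun i _ => mul_nonneg (hvnn i) (hpos i).le) h2.symm
      fun i _ => subset_convexHull ℝ _ ⟨i, rfl⟩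
  · refine convexHull_min ?_ ?_
    · rintro _ ⟨i, rfl⟩
      refine ⟨dehomogenize_mem_polyhedron hn hS (hforms i) (hne i), ?_⟩
      rw [chartForm_dehomogenize _ (hpos i).ne']
      simp [e]
    · have h : baseFace (chartForm V S) =
          polyhedron (chartForm V S) ∩ chartForm V S none ⁻¹' {0} := rfl
      rw [h]
      exact convex_polyhedron.inter ((convex_singleton 0).affine_preimage _)

theorem nonempty_orderIso_schlegelDiagram (hd : 1 ≤ d) (hn : 1 ≤ n)
    (hS : IsBoundedProjective S (domeModel V)) {y : Fin d → ℝ}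
    (hy : IsBeyond (polyhedron (chartForm V S)) (baseFace (chartForm V S)) y) :
    Nonempty (covectorDecomposition V ≃o
      schlegelDiagram (polyhedron (chartForm V S)) (baseFace (chartForm V S)) y) := by
  obtain ⟨q, hq⟩ := exists_interior hn hS
  obtain ⟨z, hz, hz'⟩ := exists_interior_baseFace hd hn hS
  have hzQ : z ∈ polyhedron (chartForm V S) := fun k => by
    cases k with
    | none => exact hz.ge
    | some φ => exact (hz' φ).le
  choose u hu using exists_corresponds (V := V) hn
  set g : TropCoord d → (Fin d → ℝ) := fun x => dehomogenize (S (u x)) with hg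
  have hpos : ∀ x, 0 < (S (u x)).2 := fun x =>
    snd_pos_of_forms_nonneg hn hS (hu x).1 (hu x).2.1
  have hgQ : ∀ x, g x ∈ polyhedron (chartForm V S) := fun x =>
    dehomogenize_mem_polyhedron hn hS (hu x).1 (hu x).2.1
  have hact : ∀ x k, chartForm V S k (g x) = 0 ↔ domeForm V k (u x) = 0 := fun x k => by
    rw [hg]
    simp only
    rw [chartForm_dehomogenize k (hpos x).ne', mul_eq_zero,
      or_iff_right (inv_ne_zero (hpos x).ne')]
  have hgQ' : ∀ x, activeFace (chartForm V S) (g x) ≠ polyhedron (chartForm V S) := by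
    intro x h
    obtain ⟨φ, hφ⟩ := (hu x).exists_some
    have : q ∈ activeFace (chartForm V S) (g x) := by rw [h]; exact fun k => (hq k).le
    exact (hq _).ne' (this.2 (some φ) ((hact x _).2 hφ))
  have hgF : ∀ x, activeFace (chartForm V S) (g x) ≠ baseFace (chartForm V S) := by
    intro x h
    obtain ⟨φ, hφ⟩ := (hu x).exists_some
    have : z ∈ activeFace (chartForm V S) (g x) := by rw [h]; exact ⟨hzQ, hz⟩
    exact (hz' _).ne' (this.2 (some φ) ((hact x _).2 hφ))
  refine nonempty_orderIso_of_range (fun x : TropCoord d => closure (covectorCell V x.toProj))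
    (fun x => centralProjection y (baseFace (chartForm V S)) (activeFace (chartForm V S) (g x)))
    ?_ ?_ fun x x' => ?_
  · ext X
    simp only [covectorDecomposition, Set.mem_ofPred_eq, Set.mem_range,
      TropCoord.toProj_surjective.exists, eq_comm]
  · refine Set.Subset.antisymm ?_ ?_
    · rintro X ⟨G, hG, hGne, hGQ, hGF, rfl⟩
      obtain ⟨w, hw, hGw⟩ := hG.exists_eq_activeFace hGne
      have hwQ := hG.subset hw
      -- If no `φ` were active at the relative interior point `w`, the face would be the base facet
      -- or the whole polytope, according to whether `none` is active.
      have hex : ∃ φ, chartForm V S (some φ) w = 0 := by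
        by_contra! hcon
        by_cases h0 : chartForm V S none w = 0
        · apply hGF
          rw [hGw]
          refine Set.Subset.antisymm (fun x hx => ⟨hx.1, hx.2 _ h0⟩) fun x hx =>
            ⟨hx.1, fun k hk => ?_⟩
          cases k with
          | none => exact hx.2
          | some φ => exact absurd hk (hcon φ)
        · apply hGQ
          rw [hGw]
          refine Set.Subset.antisymm (fun x hx => hx.1) fun x hx => ⟨hx, fun k hk => ?_⟩
          cases k with
          | none => exact absurd hk h0
          | some φ => exact absurd hk (hcon φ)
      obtain ⟨φ, hφ⟩ := hex
      obtain ⟨x, hx⟩ := exists_corresponds_of_form_eq_zero hn (u := S.symm (w, 1)) hwQ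
        (symm_mk_one_ne_zero w) hφ
      -- The vector of `w` and the chosen `u x` correspond to the same `x`, so they have the same
      -- active forms and define the same face.
      have h1 := (hx.forall_iff hn (hu x)).2 ⟨subset_rfl, fun _ => subset_rfl⟩
      have h2 := ((hu x).forall_iff hn hx).2 ⟨subset_rfl, fun _ => subset_rfl⟩
      refine ⟨x, ?_⟩
      simp only
      rw [hGw]
      congr 1
      exact Set.Subset.antisymm
        ((activeFace_subset_iff (hgQ x)).2 fun k hk => (hact x k).2 (h1 k hk))
        ((activeFace_subset_iff hwQ).2 fun k hk => h2 k ((hact x k).1 hk))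
    · rintro _ ⟨x, rfl⟩
      exact ⟨_, isExposed_activeFace _, ⟨g x, hgQ x, fun _ h => h⟩, hgQ' x, hgF x, rfl⟩
  · rw [closure_covectorCell_subset_iff, hy.centralProjection_subset_iff hq hz hz'
      (isExposed_activeFace _) (hgQ' x) (hgF x) (isExposed_activeFace _) (hgQ' x') (hgF x'),
      activeFace_subset_iff (hgQ x), ← (hu x').forall_iff hn (hu x)]
    simp only [hact]

end Model

theorem mainTheorem8 (d n : ℕ) (hd : 1 ≤ d) (hn : 1 ≤ n) (V : Matrix (Fin d) (Fin n) ℝ) :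
    (∃ T : (DomeSpace d n × ℝ) ≃ₗ[ℝ] ((Fin d → ℝ) × ℝ), IsBoundedProjective T (dome V)) ∧
    ∀ T : (DomeSpace d n × ℝ) ≃ₗ[ℝ] ((Fin d → ℝ) × ℝ), IsBoundedProjective T (dome V) →
      IsPolytope (projectiveModel T (dome V)) ∧
      IsFacet (projectiveModel T (dome V)) (faceAtInfinity T (dome V)) ∧
      IsSimplex d (faceAtInfinity T (dome V)) ∧
      (∃ y, IsBeyond (projectiveModel T (dome V)) (faceAtInfinity T (dome V)) y) ∧
      ∀ y, IsBeyond (projectiveModel T (dome V)) (faceAtInfinity T (dome V)) y →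
        Nonempty (covectorDecomposition V ≃o
          schlegelDiagram (projectiveModel T (dome V)) (faceAtInfinity T (dome V)) y) := by
  have himage := sliceEquiv_image_dome V hd hn
  constructor
  · obtain ⟨S, hS⟩ := exists_isBoundedProjective V hn
    refine ⟨((sliceEquiv d hn).prodCongr (LinearEquiv.refl ℝ ℝ)).trans S, ?_⟩
    rw [← isBoundedProjective_transport (sliceEquiv d hn), himage]
    convert hS using 1
    ext1 w
    obtain ⟨w, t⟩ := w
    obtain ⟨w, rfl⟩ := (sliceEquiv d hn).surjective w
    simp
  · intro T hT
    rw [← isBoundedProjective_transport (sliceEquiv d hn), himage] at hT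
    rw [← projectiveModel_transport (sliceEquiv d hn), ← faceAtInfinity_transport
      (sliceEquiv d hn), himage]
    set S := transportEquiv (sliceEquiv d hn) T
    have hbdd : Bornology.IsBounded (projectiveModel S (domeModel V)) := hT.2.closure
    rw [projectiveModel_eq_polyhedron hn hT] at hbdd ⊢
    rw [faceAtInfinity_eq_baseFace hn hT]
    obtain ⟨q, hq⟩ := exists_interior hn hT
    obtain ⟨z, hz, hz'⟩ := exists_interior_baseFace hd hn hT
    exact ⟨isPolytope_polyhedron hbdd, isFacet_baseFace hq hz hz', isSimplex_baseFace hn hT,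
      exists_isBeyond_baseFace hq hz hz', fun y hy =>
        nonempty_orderIso_schlegelDiagram hd hn hT hy⟩
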